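/- Let $\Phi$ be a reduced crystallographic root system of type $\mathsf{A}_\ell$ with $\ell\ge 4$, $\mathsf{D}_\ell$ with $\ell\ge 5$, or $\mathsf{E}_\ell$ with $\ell\in\{6,7,8\}$, and let $N_{\alpha,\beta}=\pm1$ (for $\alpha,\beta,\alpha+\beta\in\Phi$) be the structure constants of a Chevalley basis of the split semisimple Lie algebra of type $\Phi$, that is, $[e_\alpha,e_\beta]=N_{\alpha,\beta}e_{\alpha+\beta}$, $[e_\alpha,e_{-\alpha}]=\alpha^\vee$ and $N_{-\alpha,-\beta}=-N_{\alpha,\beta}$. For a commutative ring $S$, let $\mathrm{St}(\Phi,S)$ be the Steinberg group: the group with generators $x_\alpha(a)$, $\alpha\in\Phi$, $a\in S$, and relations $x_\alpha(a)x_\alpha(b)=x_\alpha(a+b)$; $[x_\alpha(a),x_\beta(b)]=x_{\alpha+\beta}(N_{\alpha,\beta}ab)$ if $\alpha+\beta\in\Phi$; $[x_\alpha(a),x_\beta(b)]=1$ if $\alpha+\beta\notin\Phi\cup\{0\}$. Here $[x,y]=xyx^{-1}y^{-1}$. Let $A$ be a commutative ring and $M$ an ideal of $A$. Put $t=X^{-1}$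 and let $B=A[t]+M[t^{-1}]\subseteq A[t,t^{-1}]$, graded by $\deg t=1$, so that its homogeneous components are $B_d=At^d$ for $d\ge0$ and $B_d=Mt^d$ for $d<0$. For an integer $n\ge1$ let $\mathrm{St}^{\le n}(\Phi,B)$ be the group with generators $x_\alpha(a)$, where $\alpha\in\Phi$ and $a\in B_d$ for some $d\le n$, and the following relations, where $d,e\le n$, $a,a'\in B_d$, $b\in B_e$: \begin{itemize} \item $x_\alpha(a)x_\alpha(a')=x_\alpha(a+a')$; \item $[x_\alpha(a),x_\beta(b)]=x_{\alpha+\beta}(N_{\alpha,\beta}ab)$ if $\alpha+\beta\in\Phi$ and $d+e\le n$; \item $[x_\alpha(a),x_\beta(b)]=1$ if $\alpha-\beta\in\Phi$; \item $[x_\alpha(a),x_\beta(b)]=1$ if $\alpha\perp\beta$. \end{itemize} Then for every $n\ge1$ the homomorphism $i_n\colon\mathrm{St}^{\le n}(\Phi,B)\to\mathrm{St}^{\le n+1}(\Phi,B)$, $x_\alpha(a)\mapsto x_\alpha(a)$, is an isomorphism. Moreover, there is a homomorphism $\mathrm{St}^{\le1}(\Phi,B)\to\mathrm{St}(\Phi,B)$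 with $x_\alpha(a)\mapsto x_\alpha(a)$, and it is an isomorphism. -/

import Mathlib

namespace GradedSteinberg

section RootSystem

variable {ι K V W : Type*} [Field K] [CharZero K] [AddCommGroup V] [Module K V]
  [AddCommGroup W] [Module K W]

/-- The root pairing `P` has a base whose Cartan matrix is `C`, up to numbering the simple roots. -/
def HasCartanMatrix (P : RootPairing ι K V W) [P.IsCrystallographic] {l : ℕ}
    (C : Matrix (Fin l) (Fin l) ℤ) : Prop :=
  ∃ (b : P.Base) (e : b.support ≃ Fin l), ∀ i j, b.cartanMatrix i j = C (e i) (e j)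

/-- `P` is of type `A_l` with `l ≥ 4`, `D_l` with `l ≥ 5`, `E₆`, `E₇` or `E₈`
(`CartanMatrix.A l` and `CartanMatrix.D l` are the `l × l` Cartan matrices of rank `l`). -/
def IsTypeADE (P : RootPairing ι K V W) [P.IsCrystallographic] : Prop :=
  (∃ l : ℕ, 4 ≤ l ∧ HasCartanMatrix P (CartanMatrix.A l)) ∨
  (∃ l : ℕ, 5 ≤ l ∧ HasCartanMatrix P (CartanMatrix.D l)) ∨
  HasCartanMatrix P CartanMatrix.E₆ ∨
  HasCartanMatrix P CartanMatrix.E₇ ∨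
  HasCartanMatrix P CartanMatrix.E₈

/-- A Chevalley basis of the split semisimple Lie algebra `L` with root system `P`. The map `h`
identifies the coroot space `W` with the split Cartan subalgebra of `L`, and `e i` is the root
vector of the root `P.root i`. The integers `N i j`, meaningful only if `P.root i + P.root j` is a
root, are the structure constants. -/
structure ChevalleyBasis (P : RootPairing ι K V W) (L : Type*) [LieRing L] [LieAlgebra K L] where
  /-- the inclusion of the Cartan subalgebra -/
  h : W →ₗ[K] L
  /-- the root vectors -/
  e : ι → L
  /-- the structure constants -/
  N : ι → ι → ℤ
  h_injective : Function.Injective h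
  e_linearIndependent : LinearIndependent K e
  isCompl : IsCompl (LinearMap.range h) (Submodule.span K (Set.range e))
  lie_h_h : ∀ w w' : W, ⁅h w, h w'⁆ = 0
  lie_h_e : ∀ (w : W) (i : ι), ⁅h w, e i⁆ = P.toLinearMap (P.root i) w • e i
  lie_e_neg : ∀ i j : ι, P.root j = -P.root i → ⁅e i, e j⁆ = h (P.coroot i)
  lie_e_add : ∀ i j k : ι, P.root k = P.root i + P.root j → ⁅e i, e j⁆ = N i j • e k
  lie_e_eq_zero : ∀ i j : ι, P.root i + P.root j ≠ 0 →
    P.root i + P.root j ∉ Set.range P.root → ⁅e i, e j⁆ = 0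
  N_neg : ∀ i j i' j' : ι, P.root i + P.root j ∈ Set.range P.root →
    P.root i' = -P.root i → P.root j' = -P.root j → N i' j' = -N i j

end RootSystem

noncomputable section Ring

open scoped LaurentPolynomial

variable {A : Type*} [CommRing A]

/-- The subring `B = A[t] + M[t⁻¹]` of the Laurent polynomial ring `A[t, t⁻¹]`, where `T 1` plays
the role of `t = X⁻¹`: the coefficients at the negative powers of `t` lie in `M`. -/
def ringB (M : Ideal A) : Subring A[T;T⁻¹] where
  carrier := {f | ∀ d : ℤ, d < 0 → f.coeff d ∈ M}
  zero_mem' := by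
    intro d _
    simp
  one_mem' := by
    intro d hd
    rw [← LaurentPolynomial.T_zero, LaurentPolynomial.T, AddMonoidAlgebra.coeff_single,
      Finsupp.single_eq_of_ne (by omega)]
    exact M.zero_mem
  add_mem' := by
    intro f g hf hg d hd
    simpa using M.add_mem (hf d hd) (hg d hd)
  neg_mem' := by
    intro f hf d hd
    simpa using M.neg_mem (hf d hd)
  mul_mem' := by
    intro f g hf hg d hd
    rw [AddMonoidAlgebra.coeff_mul]
    refine Ideal.sum_mem _ fun i _ => Ideal.sum_mem _ fun j _ => ?_
    dsimp only
    split_ifs with hij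
    · rcases lt_or_ge i 0 with hi | hi
      · exact M.mul_mem_right _ (hf i hi)
      · exact M.mul_mem_left _ (hg j (by omega))
    · exact M.zero_mem

/-- The homogeneous component `B_d` of `B`, for the grading in which `t` has degree `1`. -/
def homB (M : Ideal A) (d : ℤ) : AddSubgroup (ringB M) :=
  (AddMonoidAlgebra.grade A d).toAddSubgroup.comap (ringB M).subtype.toAddMonoidHom

/-- The homogeneous elements of `B` of degree at most `n`. -/
abbrev HomCoeff (M : Ideal A) (n : ℤ) : Type _ :=
  {a : ringB M // ∃ d : ℤ, d ≤ n ∧ a ∈ homB M d}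

end Ring

noncomputable section Groups

open scoped commutatorElement

variable {ι K V W : Type*} [Field K] [AddCommGroup V] [Module K V] [AddCommGroup W] [Module K W]
  (P : RootPairing ι K V W) (N : ι → ι → ℤ)

open FreeGroup in
/-- The Steinberg relations over a commutative ring `S`, in the form that they take for a
simply-laced root system with structure constants `N`. -/
inductive SteinbergRel (S : Type*) [CommRing S] : FreeGroup (ι × S) → Prop
  | add (i : ι) (a b : S) :
      SteinbergRel S (of (i, a) * of (i, b) * (of (i, a + b))⁻¹)
  | comm_add (i j k : ι) (a b : S) (hk : P.root k = P.root i + P.root j) :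
      SteinbergRel S (⁅of (i, a), of (j, b)⁆ * (of (k, N i j • (a * b)))⁻¹)
  | comm_one (i j : ι) (a b : S) (h0 : P.root i + P.root j ≠ 0)
      (h : P.root i + P.root j ∉ Set.range P.root) :
      SteinbergRel S ⁅of (i, a), of (j, b)⁆

/-- The Steinberg group `St(P, S)` of a simply-laced root system. -/
abbrev Steinberg (S : Type*) [CommRing S] : Type _ :=
  PresentedGroup {r : FreeGroup (ι × S) | SteinbergRel P N S r}

/-- The generator `x_i(a)` of the Steinberg group. -/
def Steinberg.x {S : Type*} [CommRing S] (i : ι) (a : S) : Steinberg P N S :=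
  PresentedGroup.of (i, a)

variable {A : Type*} [CommRing A] (M : Ideal A)

open FreeGroup in
/-- The Steinberg relations of degree at most `n` between homogeneous generators of degree at
most `n`. The degree of a relation is the maximum of the degrees of the generators in it. -/
inductive TruncRel (n : ℤ) : FreeGroup (ι × HomCoeff M n) → Prop
  | add (i : ι) (d : ℤ) (hd : d ≤ n) (a b c : HomCoeff M n)
      (ha : a.1 ∈ homB M d) (hb : b.1 ∈ homB M d) (hc : c.1 = a.1 + b.1) :
      TruncRel n (of (i, a) * of (i, b) * (of (i, c))⁻¹)
  | comm_add (i j k : ι) (hk : P.root k = P.root i + P.root j)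
      (d e : ℤ) (hd : d ≤ n) (he : e ≤ n) (hde : d + e ≤ n) (a b c : HomCoeff M n)
      (ha : a.1 ∈ homB M d) (hb : b.1 ∈ homB M e) (hc : c.1 = N i j • (a.1 * b.1)) :
      TruncRel n (⁅of (i, a), of (j, b)⁆ * (of (k, c))⁻¹)
  | comm_acute (i j : ι) (h : P.root i - P.root j ∈ Set.range P.root)
      (d e : ℤ) (hd : d ≤ n) (he : e ≤ n) (a b : HomCoeff M n)
      (ha : a.1 ∈ homB M d) (hb : b.1 ∈ homB M e) :
      TruncRel n ⁅of (i, a), of (j, b)⁆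
  | comm_orthogonal (i j : ι) (h : P.IsOrthogonal i j)
      (d e : ℤ) (hd : d ≤ n) (he : e ≤ n) (a b : HomCoeff M n)
      (ha : a.1 ∈ homB M d) (hb : b.1 ∈ homB M e) :
      TruncRel n ⁅of (i, a), of (j, b)⁆

/-- The truncated Steinberg group `St^{≤ n}(P, B)`. -/
abbrev TruncSteinberg (n : ℤ) : Type _ :=
  PresentedGroup {r : FreeGroup (ι × HomCoeff M n) | TruncRel P N M n r}

/-- The generator `x_i(a)` of the truncated Steinberg group. -/
def TruncSteinberg.x {n : ℤ} (i : ι) (a : HomCoeff M n) : TruncSteinberg P N M n :=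
  PresentedGroup.of (i, a)

variable {M} in
/-- A homogeneous element of degree at most `n`, seen as one of degree at most `n + 1`. -/
def HomCoeff.succ {n : ℤ} (a : HomCoeff M n) : HomCoeff M (n + 1) :=
  ⟨a.1, a.2.imp fun _ hd => ⟨by omega, hd.2⟩⟩

theorem TruncRel.lift_eq_one {n : ℤ} {r : FreeGroup (ι × HomCoeff M n)}
    (hr : TruncRel P N M n r) :
    FreeGroup.lift (fun g : ι × HomCoeff M n => TruncSteinberg.x P N M g.1 g.2.succ) r = 1 := by
  have key : ∀ {s : FreeGroup (ι × HomCoeff M (n + 1))}, TruncRel P N M (n + 1) s →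
      (PresentedGroup.mk {r | TruncRel P N M (n + 1) r} s) = 1 := fun hs =>
    (QuotientGroup.eq_one_iff _).2 (Subgroup.subset_normalClosure hs)
  cases hr with
  | add i d hd a b c ha hb hc =>
    simpa [TruncSteinberg.x, PresentedGroup.of] using key (.add i d (by omega) a.succ b.succ c.succ ha hb hc)
  | comm_add i j k hk d e hd he hde a b c ha hb hc =>
    simpa [TruncSteinberg.x, PresentedGroup.of] using key (.comm_add i j k hk d e (by omega) (by omega) (by omega)
      a.succ b.succ c.succ ha hb hc)
  | comm_acute i j h d e hd he a b ha hb =>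
    simpa [TruncSteinberg.x, PresentedGroup.of] using key (.comm_acute i j h d e (by omega) (by omega) a.succ b.succ ha hb)
  | comm_orthogonal i j h d e hd he a b ha hb =>
    simpa [TruncSteinberg.x, PresentedGroup.of] using key (.comm_orthogonal i j h d e (by omega) (by omega) a.succ b.succ ha hb)

/-- The homomorphism `i_n : St^{≤ n}(P, B) → St^{≤ n+1}(P, B)` induced by the inclusion of the
generators, `x_i(a) ↦ x_i(a)`. -/
def TruncSteinberg.incl (n : ℤ) : TruncSteinberg P N M n →* TruncSteinberg P N M (n + 1) :=
  PresentedGroup.toGroup (f := fun g : ι × HomCoeff M n => TruncSteinberg.x P N M g.1 g.2.succ)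
    fun _ hr => TruncRel.lift_eq_one P N M hr

end Groups

end GradedSteinberg

/-! Each `i_n` is inverted by building the missing generators inside the smaller group. If `α = β +
γ` and the positive degrees of `a`, `b` add up to `n + 1`, then `x_α(N a b)` has to be `⁅x_β(a),
x_γ(b)⁆`, a commutator of elements of degree at most `n`. The work is to show that this commutator
depends only on `α` and on `N a b` (`comm_eq_of_smul_eq`) and that the new elements satisfy all
relations of degree `n + 1` (`succ_of_isTop`). Both are stated for families of elements of an
arbitrary group, which gives `exists_succ`: a family of level `n ≥ 1` extends to level `n + 1` in
the same group.

The engine is the Hall–Witt identity in the form `commutator_commutator_left`: if `α = β + γ = β' +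
γ'` and `ρ = β - β' = γ' - γ` is a root, then expanding `x_β` as `⁅x_ρ, x_β'⁆` moves a factor of the
coefficient from `x_β` to `x_γ'` (`comm_eq_comm`). Every commutator in degree `n + 1` is thereby
brought to the form `⁅x_β'(t), x_γ'(c)⁆`.

The auxiliary roots needed are collected in `IsAmple`, derived from irreducibility and rank. In rank
4 this fails for `D₄` and is checked separately for `A₄`.

Applied to the generators of `St^{≤n}`, `exists_succ` gives a left inverse of `i_n`; surjectivity
holds since an element of degree `n + 1` is a multiple of `t`. Iterating from level 1 and
multiplying homogeneous components gives the inverse of `St^{≤1} → St`. -/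

namespace GradedSteinberg

/-! ### Root combinatorics expressed by integer pairings. -/

/-- The combinatorics of a simply-laced root system: `p i j` is the pairing of the `i`-th root with
the `j`-th coroot, and `IsSum i j k` says that the `k`-th root is the sum of the `i`-th and the
`j`-th root. -/
structure RootCombinatorics (ι : Type*) where
  /-- the pairing of roots with coroots -/
  p : ι → ι → ℤ
  /-- the relation of being a sum -/
  IsSum : ι → ι → ι → Prop
  /-- the index of the opposite root -/
  neg : ι → ι
  p_self : ∀ i, p i i = 2
  p_symm : ∀ i j, p i j = p j i
  p_le : ∀ i j, p i j ≤ 2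
  eq_of_p : ∀ i j, p i j = 2 → i = j
  p_neg : ∀ i j, p (neg i) j = -p i j
  p_sum : ∀ {i j k}, IsSum i j k → ∀ m, p k m = p i m + p j m
  exists_isSum : ∀ i j, p i j = -1 → ∃ k, IsSum i j k

namespace RootCombinatorics

variable {ι : Type*} (D : RootCombinatorics ι)

theorem p_neg_right (i j : ι) : D.p i (D.neg j) = -D.p i j := by
  rw [D.p_symm, D.p_neg, D.p_symm]

theorem neg_two_le (i j : ι) : -2 ≤ D.p i j := by
  have := D.p_le (D.neg i) j
  rw [D.p_neg] at this
  omega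

theorem eq_neg_of_p {i j : ι} (h : D.p i j = -2) : i = D.neg j :=
  D.eq_of_p _ _ (by rw [D.p_neg_right]; omega)

variable {D}

theorem IsSum.p_right {i j k : ι} (h : D.IsSum i j k) (m : ι) : D.p m k = D.p m i + D.p m j := by
  rw [D.p_symm m k, D.p_sum h, D.p_symm i, D.p_symm j]

theorem IsSum.p_eq {i j k : ι} (h : D.IsSum i j k) :
    D.p i j = -1 ∧ D.p i k = 1 ∧ D.p j k = 1 := by
  have h1 := h.p_right i
  have h2 := h.p_right j
  have h3 := h.p_right k
  have h4 := D.p_self i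
  have h5 := D.p_self j
  have h6 := D.p_self k
  have h7 := D.p_symm i j
  have h8 := D.p_symm i k
  have h9 := D.p_symm j k
  omega

/-- The sum of `i` and `j` pairs with `k` to 2, so it is `k`. Thus sums of roots are recognised from
pairings alone. -/
theorem isSum_of_p {i j k : ι} (hij : D.p i j = -1) (hi : D.p i k = 1) (hj : D.p j k = 1) :
    D.IsSum i j k := by
  obtain ⟨m, hm⟩ := D.exists_isSum i j hij
  obtain rfl : m = k := D.eq_of_p _ _ (by rw [D.p_sum hm]; omega)
  exact hm

theorem IsSum.symm {i j k : ι} (h : D.IsSum i j k) : D.IsSum j i k := by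
  have := h.p_eq
  exact isSum_of_p (by rw [D.p_symm]; omega) this.2.2 this.2.1

theorem exists_isSum_sub {i j : ι} (h : D.p i j = 1) : ∃ k, D.IsSum j k i := by
  obtain ⟨k, hk⟩ := D.exists_isSum i (D.neg j) (by rw [D.p_neg_right, h])
  refine ⟨k, isSum_of_p ?_ ?_ ?_⟩
  · rw [hk.p_right, D.p_neg_right, D.p_self, D.p_symm, h]; rfl
  · rw [D.p_symm, h]
  · rw [D.p_sum hk, D.p_neg, D.p_self, D.p_symm j, h]; rfl

/-- If every root forming an acute angle with `α` is not orthogonal to `ρ`, then `ρ` is orthogonal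
to every root orthogonal to `α`, except for `ρ` and its opposite. -/
theorem p_eq_of_forall_p_ne_zero {α ρ : ι} (hαρ : D.p ρ α = 0) (hne : ∃ β, D.p β α = 1)
    (hbad : ∀ σ, D.p σ α = 1 → D.p σ ρ ≠ 0) {τ : ι} (hτ : D.p τ α = 0) :
    D.p τ ρ = 0 ∨ τ = ρ ∨ τ = D.neg ρ := by
  have key : ∀ τ, D.p τ α = 0 → D.p τ ρ ≠ 1 := by
    intro τ hτ hτρ
    obtain ⟨μ, hμ, hμρ⟩ : ∃ μ, D.p μ α = 1 ∧ D.p μ ρ = -1 := by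
      obtain ⟨β, hβ⟩ := hne
      have h1 := hbad β hβ
      have h2 := D.p_le β ρ
      have h3 := D.neg_two_le β ρ
      have h4 : D.p β ρ ≠ 2 := fun h => by
        rw [D.eq_of_p _ _ h] at hβ; omega
      have h5 : D.p β ρ ≠ -2 := fun h => by
        rw [D.eq_neg_of_p h, D.p_neg] at hβ; omega
      rcases (by omega : D.p β ρ = 1 ∨ D.p β ρ = -1) with h | h
      · obtain ⟨k, hk⟩ := exists_isSum_sub h
        have e1 := D.p_sum hk α
        have e2 := D.p_sum hk ρ
        rw [D.p_self] at e2
        exact ⟨k, by omega, by omega⟩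
      · exact ⟨β, hβ, h⟩
    have addC : ∀ k, D.p k α = 1 → D.p k ρ = -1 → D.p k τ = -1 → False := by
      intro k h1 h2 h3
      obtain ⟨m, hm⟩ := D.exists_isSum k τ h3
      have e1 := D.p_sum hm α
      have e2 := D.p_sum hm ρ
      exact hbad m (by omega) (by omega)
    -- With `k = α - μ` and `m = k - ρ`, the root `m` also pairs to 1 with `α` and to -1 with `ρ`,
    -- and `p m τ = -p μ τ - 1`. So `μ + τ` or `m + τ` is a root acute to `α` and orthogonal to `ρ`,
    -- unless `m = -τ`, which is orthogonal to `α`.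
    obtain ⟨k, hk⟩ := exists_isSum_sub (D.p_symm α μ ▸ hμ : D.p α μ = 1)
    have a1 := D.p_sum hk α
    have a2 := D.p_sum hk ρ
    have a3 := D.p_sum hk τ
    rw [D.p_self] at a1
    rw [D.p_symm α ρ] at a2
    rw [D.p_symm α τ] at a3
    obtain ⟨m, hm⟩ := exists_isSum_sub (by omega : D.p k ρ = 1)
    have b1 := D.p_sum hm α
    have b2 := D.p_sum hm ρ
    have b3 := D.p_sum hm τ
    rw [D.p_self] at b2
    rw [D.p_symm ρ τ] at b3
    have h2 := D.p_le μ τ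
    have h3 := D.neg_two_le μ τ
    have h4 : D.p μ τ ≠ 2 := fun h => by
      rw [D.eq_of_p _ _ h] at hμ; omega
    have h5 : D.p μ τ ≠ -2 := fun h => by
      rw [D.eq_neg_of_p h, D.p_neg] at hμ; omega
    rcases (by omega : D.p μ τ = 1 ∨ D.p μ τ = -1 ∨ D.p μ τ = 0) with h | h | h
    · have := D.eq_neg_of_p (by omega : D.p m τ = -2)
      rw [this, D.p_neg] at b1
      omega
    · exact addC μ hμ hμρ h
    · exact addC m (by omega) (by omega) (by omega)
  have h1 := key τ hτ
  have h2 := key (D.neg τ) (by rw [D.p_neg]; omega)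
  rw [D.p_neg] at h2
  have h3 := D.p_le τ ρ
  have h4 := D.neg_two_le τ ρ
  rcases (by omega : D.p τ ρ = 0 ∨ D.p τ ρ = 2 ∨ D.p τ ρ = -2) with h | h | h
  · exact .inl h
  · exact .inr (.inl (D.eq_of_p _ _ h))
  · exact .inr (.inr (D.eq_neg_of_p h))

variable (D) in
/-- The richness conditions on a simply-laced root system that the computations in the truncated
Steinberg groups use. They hold for the irreducible systems of rank at least `4` other than
`D₄`. -/
structure IsAmple : Prop where
  exists_acute : ∀ α, ∃ β, D.p β α = 1
  exists_acute_obtuse : ∀ α ρ, D.p α ρ = 0 → ∃ σ, D.p σ α = 1 ∧ D.p σ ρ = -1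
  exists_orthogonal : ∀ α β, D.p β α = 1 →
    ∃ ρ, D.p ρ α = 0 ∧ D.p ρ β = 1 ∧ ∃ σ, D.p σ α = 1 ∧ D.p σ ρ = 0

end RootCombinatorics

section OfRootPairing

variable {ι K V W : Type*} [Finite ι] [Field K] [CharZero K] [AddCommGroup V] [Module K V]
  [AddCommGroup W] [Module K W] {P : RootPairing ι K V W} [P.IsCrystallographic] [P.IsReduced]

/-- The combinatorics of a reduced root pairing with symmetric pairing. -/
noncomputable def rootCombinatorics (hs : ∀ i j, P.pairingIn ℤ i j = P.pairingIn ℤ j i) :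
    RootCombinatorics ι where
  p := P.pairingIn ℤ
  IsSum i j k := P.root k = P.root i + P.root j
  neg i := P.reflectionPerm i i
  p_self := by simp
  p_symm := hs
  p_le i j := by
    have h := P.pairingIn_pairingIn_mem_set_of_isCrystal_of_isRed i j
    have := hs i j
    simp only [Set.mem_insert_iff, Prod.mk.injEq, Set.mem_singleton_iff] at h
    omega
  eq_of_p i j h := (P.pairingIn_two_two_iff ℤ i j).1 ⟨h, hs i j ▸ h⟩
  p_neg i j := by simp
  p_sum h m := P.pairingIn_eq_add_of_root_eq_add h
  exists_isSum i j h := by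
    obtain ⟨k, hk⟩ := P.root_add_root_mem_of_pairingIn_neg (i := i) (j := j) (by omega) (by
      intro hij
      have := (P.pairingIn_neg_two_neg_two_iff ℤ i j).2 hij
      omega)
    exact ⟨k, hk⟩

theorem root_reflectionPerm_self {ι K V W : Type*} [Field K] [AddCommGroup V] [Module K V]
    [AddCommGroup W] [Module K W] (P : RootPairing ι K V W) (i : ι) :
    P.root (P.reflectionPerm i i) = -P.root i := by
  simp [P.root_reflectionPerm]

theorem isOrthogonal_iff_pairingIn {ι K V W : Type*} [Field K] [CharZero K] [AddCommGroup V]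
    [Module K V] [AddCommGroup W] [Module K W] {P : RootPairing ι K V W} [P.IsCrystallographic]
    {i j : ι} : P.IsOrthogonal i j ↔ P.pairingIn ℤ i j = 0 := by
  rw [P.isOrthogonal_iff_pairing_eq_zero, ← P.algebraMap_pairingIn ℤ]
  simp

end OfRootPairing

end GradedSteinberg

/-! ### Auxiliary roots from irreducibility and rank. -/

namespace GradedSteinberg

section Irreducible

open Submodule RootCombinatorics

variable {ι K V W : Type*} [Finite ι] [Field K] [CharZero K] [AddCommGroup V] [Module K V]
  [AddCommGroup W] [Module K W] {P : RootPairing ι K V W} [P.IsCrystallographic] [P.IsReduced]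
  (hs : ∀ i j, P.pairingIn ℤ i j = P.pairingIn ℤ j i)

/-- If every root lies in the span of a nonempty set of roots or is orthogonal to that set, then
the set spans the whole space. -/
def IsConnectedRoots (P : RootPairing ι K V W) [P.IsCrystallographic] : Prop :=
  ∀ s : Set ι, s.Nonempty →
    (∀ i, P.root i ∈ span K (P.root '' s) ∨ ∀ j ∈ s, P.pairingIn ℤ j i = 0) →
    span K (P.root '' s) = ⊤

omit [Finite ι] [P.IsReduced] in
theorem span_ne_top_of_forall_pairingIn_eq_zero {s : Set ι} {i : ι}
    (h : ∀ j ∈ s, P.pairingIn ℤ j i = 0) : span K (P.root '' s) ≠ ⊤ := by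
  intro htop
  have hle : span K (P.root '' s) ≤ LinearMap.ker (P.coroot' i) := by
    rw [span_le]
    rintro _ ⟨j, hj, rfl⟩
    have := congrArg (algebraMap ℤ K) (h j hj)
    rw [P.algebraMap_pairingIn, map_zero] at this
    simpa [P.root_coroot'_eq_pairing] using this
  have hi : P.root i ∈ LinearMap.ker (P.coroot' i) := hle (htop ▸ mem_top)
  rw [LinearMap.mem_ker, P.root_coroot'_eq_pairing, P.pairing_same] at hi
  exact two_ne_zero hi

-- Otherwise every root is `±α` or orthogonal to `α`, and `α` alone would span.
include hs in
theorem exists_pairingIn_eq_one (hirr : IsConnectedRoots P)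
    (h2 : ∀ a b, span K (P.root '' {a, b}) ≠ ⊤) (α : ι) : ∃ β, P.pairingIn ℤ β α = 1 := by
  by_contra! hno
  refine h2 α α (hirr _ (by simp) fun i => ?_)
  let D := rootCombinatorics hs
  have h1 : D.p i α ≠ 1 := hno i
  have h2 : D.p (D.neg i) α ≠ 1 := hno _
  have h3 := D.p_le i α
  have h4 := D.neg_two_le i α
  rw [D.p_neg] at h2
  rcases (by omega : D.p i α = 0 ∨ D.p i α = 2 ∨ D.p i α = -2) with h | h | h
  · right
    intro j hj
    obtain rfl : j = α := by simpa using hj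
    rw [hs]
    exact h
  · left
    rw [D.eq_of_p _ _ h]
    exact subset_span (by simp)
  · left
    have : P.root i = -P.root α := by
      rw [D.eq_neg_of_p h]
      exact root_reflectionPerm_self P α
    rw [this]
    exact neg_mem (subset_span (by simp))

-- Some root is orthogonal to neither `α` nor `ρ`: otherwise the roots not orthogonal to `α` would
-- all be orthogonal to `ρ`, yet by connectedness they span. Adding `α` or subtracting `ρ` then
-- corrects the two signs independently, as `α ⟂ ρ`.
include hs in
theorem exists_pairingIn_eq_one_and_eq_neg_one (hirr : IsConnectedRoots P) {α ρ : ι}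
    (hαρ : P.pairingIn ℤ α ρ = 0) :
    ∃ σ, P.pairingIn ℤ σ α = 1 ∧ P.pairingIn ℤ σ ρ = -1 := by
  let D := rootCombinatorics hs
  change D.p α ρ = 0 at hαρ
  change ∃ σ, D.p σ α = 1 ∧ D.p σ ρ = -1
  obtain ⟨σ, hσα, hσρ⟩ : ∃ σ, D.p σ α ≠ 0 ∧ D.p σ ρ ≠ 0 := by
    by_contra! hno
    refine span_ne_top_of_forall_pairingIn_eq_zero (s := {σ | D.p σ α ≠ 0}) (i := ρ) hno
      (hirr _ ⟨α, by simp [D.p_self]⟩ fun i => ?_)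
    by_cases hi : D.p i α = 0
    swap
    · exact .inl (subset_span ⟨i, hi, rfl⟩)
    by_cases hσ : ∀ j, D.p j α ≠ 0 → D.p j i = 0
    · exact .inr hσ
    push Not at hσ
    obtain ⟨j, hj, hji⟩ := hσ
    left
    have h3 := D.p_le j i
    have h4 := D.neg_two_le j i
    have h5 : D.p j i ≠ 2 := fun h => hj (by rw [D.eq_of_p _ _ h]; exact hi)
    have h6 : D.p j i ≠ -2 := fun h => hj (by rw [D.eq_neg_of_p h, D.p_neg, hi]; rfl)
    rcases (by omega : D.p j i = 1 ∨ D.p j i = -1) with h | h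
    · obtain ⟨k, hk⟩ := exists_isSum_sub h
      have e := D.p_sum hk α
      have hr : P.root i = P.root j - P.root k := eq_sub_of_add_eq (Eq.symm hk)
      rw [hr]
      exact sub_mem (subset_span ⟨j, hj, rfl⟩) (subset_span ⟨k, by simp; omega, rfl⟩)
    · obtain ⟨k, hk⟩ := D.exists_isSum j i h
      have e := D.p_sum hk α
      have hr : P.root i = P.root k - P.root j := eq_sub_of_add_eq (hk.trans (add_comm _ _)).symm
      rw [hr]
      exact sub_mem (subset_span ⟨k, by simp; omega, rfl⟩) (subset_span ⟨j, hj, rfl⟩)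
  have a1 := D.p_le σ α
  have a2 := D.neg_two_le σ α
  have a3 : D.p σ α ≠ 2 := fun h => hσρ (by rw [D.eq_of_p _ _ h]; exact hαρ)
  have a4 : D.p σ α ≠ -2 := fun h => hσρ (by rw [D.eq_neg_of_p h, D.p_neg, hαρ]; rfl)
  have hρα := D.p_symm ρ α
  have b1 := D.p_le σ ρ
  have b2 := D.neg_two_le σ ρ
  have b3 : D.p σ ρ ≠ 2 := fun h => hσα (by rw [D.eq_of_p _ _ h]; omega)
  have b4 : D.p σ ρ ≠ -2 := fun h => hσα (by rw [D.eq_neg_of_p h, D.p_neg]; omega)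
  obtain ⟨τ, hτα, hτρ⟩ : ∃ τ, D.p τ α = 1 ∧ D.p τ ρ = D.p σ ρ := by
    rcases (by omega : D.p σ α = 1 ∨ D.p σ α = -1) with h | h
    · exact ⟨σ, h, rfl⟩
    · obtain ⟨k, hk⟩ := D.exists_isSum σ α h
      have e1 := D.p_sum hk α
      have e2 := D.p_sum hk ρ
      rw [D.p_self] at e1
      exact ⟨k, by omega, by omega⟩
  rcases (by omega : D.p τ ρ = 1 ∨ D.p τ ρ = -1) with h | h
  · obtain ⟨k, hk⟩ := exists_isSum_sub h
    have e1 := D.p_sum hk α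
    have e2 := D.p_sum hk ρ
    rw [D.p_self] at e2
    exact ⟨k, by omega, by omega⟩
  · exact ⟨τ, hτα, h⟩

-- If every `ρ` orthogonal to `α` and acute to `β` failed, distinct such `ρ` would be mutually
-- orthogonal, and `α`, `β` and at most two of them would span everything, the configuration of
-- `D₄`. Hypothesis `h4` excludes this by rank, or rules out failing pairs outright.
include hs in
theorem exists_pairingIn_orthogonal (hirr : IsConnectedRoots P)
    (h2 : ∀ a b, span K (P.root '' {a, b}) ≠ ⊤)
    (h4 : (∀ a b c d, span K (P.root '' {a, b, c, d}) ≠ ⊤) ∨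
      ∀ α ρ, P.pairingIn ℤ ρ α = 0 → ∃ σ, P.pairingIn ℤ σ α = 1 ∧ P.pairingIn ℤ σ ρ = 0)
    {α β : ι} (hβ : P.pairingIn ℤ β α = 1) :
    ∃ ρ, P.pairingIn ℤ ρ α = 0 ∧ P.pairingIn ℤ ρ β = 1 ∧
      ∃ σ, P.pairingIn ℤ σ α = 1 ∧ P.pairingIn ℤ σ ρ = 0 := by
  let D := rootCombinatorics hs
  change D.p β α = 1 at hβ
  have hβ' := D.p_symm α β
  have hsub : ∀ {i j k}, D.IsSum i j k → P.root k = P.root i + P.root j := fun h => h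
  have hneg : ∀ i, P.root (D.neg i) = -P.root i := root_reflectionPerm_self P
  -- every root is spanned by a suitable set, or orthogonal to it
  have hcover : ∀ s : Set ι, α ∈ s → β ∈ s → (∀ ρ ∈ s, ρ = α ∨ ρ = β ∨ (D.p ρ α = 0 ∧
      D.p ρ β = 1)) → (∀ ρ, D.p ρ α = 0 → D.p ρ β = 1 → P.root ρ ∈ span K (P.root '' s)) →
      (∀ ρ τ, D.p ρ α = 0 → D.p ρ β = 1 → D.p τ α = 0 →
        D.p τ ρ = 0 ∨ τ = ρ ∨ τ = D.neg ρ) → span K (P.root '' s) = ⊤ := by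
    intro s hαs hβs hs' hspan hbad
    refine hirr _ ⟨α, hαs⟩ fun σ => ?_
    set U := span K (P.root '' s)
    have hα : P.root α ∈ U := subset_span ⟨α, hαs, rfl⟩
    have hβU : P.root β ∈ U := subset_span ⟨β, hβs, rfl⟩
    have adj : ∀ σ, D.p σ α = 1 → D.p σ β = 1 → P.root σ ∈ U := by
      intro σ h1 h2
      obtain ⟨k, hk⟩ := exists_isSum_sub (D.p_symm β σ ▸ h2 : D.p β σ = 1)
      have e1 := D.p_sum hk α
      have e2 := D.p_sum hk β
      rw [D.p_self] at e2
      have := sub_mem hβU (hspan k (by omega) (by omega))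
      rwa [hsub hk, add_sub_cancel_right] at this
    have pos : ∀ σ, D.p σ α = 1 → P.root σ ∈ U := by
      intro σ h1
      have h2 := D.p_le σ β
      have h3 := D.neg_two_le σ β
      have h1' := D.p_symm σ α
      rcases (by omega : D.p σ β = 2 ∨ D.p σ β = 1 ∨ D.p σ β = 0 ∨ D.p σ β = -1 ∨ D.p σ β = -2)
        with h | h | h | h | h
      · rw [D.eq_of_p _ _ h]; exact hβU
      · exact adj σ h1 h
      · obtain ⟨k, hk⟩ := exists_isSum_sub (by omega : D.p α σ = 1)
        have e1 := D.p_sum hk α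
        have e2 := D.p_sum hk β
        rw [D.p_self] at e1
        have := sub_mem hα (adj k (by omega) (by omega))
        rwa [hsub hk, add_sub_cancel_right] at this
      · have := sub_mem hα hβU
        rwa [hsub (isSum_of_p h h1 hβ), add_sub_cancel_right] at this
      · rw [D.eq_neg_of_p h, D.p_neg] at h1
        omega
    have h2 := D.p_le σ α
    have h3 := D.neg_two_le σ α
    rcases (by omega : D.p σ α = 2 ∨ D.p σ α = 1 ∨ D.p σ α = 0 ∨ D.p σ α = -1 ∨ D.p σ α = -2)
        with h | h | h | h | h
    · rw [D.eq_of_p _ _ h]; exact .inl hα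
    · exact .inl (pos σ h)
    · have hneg1 : ∀ ρ, D.p ρ α = 0 → D.p ρ β = 1 → P.root (D.neg ρ) ∈ U := fun ρ h h' => by
        rw [hneg]; exact neg_mem (hspan ρ h h')
      have h5 := D.p_le σ β
      have h6 := D.neg_two_le σ β
      rcases (by omega : D.p σ β = 2 ∨ D.p σ β = 1 ∨ D.p σ β = 0 ∨ D.p σ β = -1 ∨ D.p σ β = -2)
        with h' | h' | h' | h' | h'
      · rw [D.eq_of_p _ _ h']; exact .inl hβU
      · exact .inl (hspan σ h h')
      · by_cases hU : P.root σ ∈ U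
        · exact .inl hU
        right
        intro j hj
        rw [hs]
        rcases hs' j hj with rfl | rfl | ⟨ha, hb⟩
        · exact h
        · exact h'
        · rcases hbad j σ ha hb h with h | rfl | rfl
          · exact h
          · omega
          · exact absurd (hneg1 j ha hb) hU
      · left
        have := neg_mem (hspan (D.neg σ) (by rw [D.p_neg]; omega) (by rw [D.p_neg]; omega))
        rwa [hneg, neg_neg] at this
      · left
        rw [D.eq_neg_of_p h', hneg]; exact neg_mem hβU
    · left
      have := neg_mem (pos (D.neg σ) (by rw [D.p_neg]; omega))
      rwa [hneg, neg_neg] at this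
    · left
      rw [D.eq_neg_of_p h, hneg]; exact neg_mem hα
  obtain ⟨ρ₁, h1α, h1β⟩ : ∃ ρ, D.p ρ α = 0 ∧ D.p ρ β = 1 := by
    by_contra! hno
    refine h2 α β (hcover _ (by simp) (by simp) ?_ (fun ρ h h' => absurd h' (hno ρ h))
      fun ρ _ h h' => absurd h' (hno ρ h))
    rintro ρ (rfl | hρ)
    · exact .inl rfl
    · exact .inr (.inl (by simpa using hρ))
  by_contra! hno
  change ∀ ρ, D.p ρ α = 0 → D.p ρ β = 1 → ∀ σ, D.p σ α = 1 → D.p σ ρ ≠ 0 at hno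
  rcases h4 with h4 | h4
  swap
  · obtain ⟨σ, h, h'⟩ := h4 α ρ₁ h1α
    exact hno _ h1α h1β σ h h'
  have hbad : ∀ ρ τ, D.p ρ α = 0 → D.p ρ β = 1 → D.p τ α = 0 →
        D.p τ ρ = 0 ∨ τ = ρ ∨ τ = D.neg ρ := fun ρ τ h h' h'' =>
    p_eq_of_forall_p_ne_zero h ⟨β, hβ⟩ (hno ρ h h') h''
  have horth : ∀ ρ τ, D.p ρ α = 0 → D.p ρ β = 1 → D.p τ α = 0 → D.p τ β = 1 → τ ≠ ρ →
      D.p τ ρ = 0 := by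
    intro ρ τ h h' h'' h''' hne
    rcases hbad ρ τ h h' h'' with h1 | h1 | h1
    · exact h1
    · exact absurd h1 hne
    · rw [h1, D.p_neg] at h'''
      omega
  obtain ⟨ρ₂, h2α, h2β, hall⟩ : ∃ ρ₂, D.p ρ₂ α = 0 ∧ D.p ρ₂ β = 1 ∧ ∀ ρ, D.p ρ α = 0 →
      D.p ρ β = 1 → P.root ρ ∈ span K (P.root '' {α, β, ρ₁, ρ₂}) := by
    by_cases hex : ∃ ρ₂, D.p ρ₂ α = 0 ∧ D.p ρ₂ β = 1 ∧ ρ₂ ≠ ρ₁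
    · obtain ⟨ρ₂, h2α, h2β, hne⟩ := hex
      refine ⟨ρ₂, h2α, h2β, fun ρ hα hβ1 => ?_⟩
      have hmem : ∀ i ∈ ({α, β, ρ₁, ρ₂} : Set ι), P.root i ∈
        span K (P.root '' {α, β, ρ₁, ρ₂}) := fun i hi => subset_span ⟨i, hi, rfl⟩
      by_cases hr1 : ρ = ρ₁
      · rw [hr1]; exact hmem _ (by simp)
      by_cases hr2 : ρ = ρ₂
      · rw [hr2]; exact hmem _ (by simp)
      have o12 := horth ρ₁ ρ₂ h1α h1β h2α h2β hne
      have o13 := horth ρ₁ ρ h1α h1β hα hβ1 hr1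
      have o23 := horth ρ₂ ρ h2α h2β hα hβ1 hr2
      have s21 := D.p_symm ρ₁ ρ₂
      have s31 := D.p_symm ρ₁ ρ
      have s32 := D.p_symm ρ₂ ρ
      -- `q = β - ρ₁ - ρ₂ - ρ` is a root with `β + q = α`, whence `ρ = 2β - α - ρ₁ - ρ₂`.
      obtain ⟨k, hk⟩ := exists_isSum_sub (D.p_symm β ρ₁ ▸ h1β : D.p β ρ₁ = 1)
      have k1 := D.p_sum hk α
      have k2 := hk.p_right ρ₂
      have k3 := hk.p_right ρ
      have k4 := hk.p_right β
      have k5 := D.p_symm β ρ₁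
      obtain ⟨m, hm⟩ := exists_isSum_sub (D.p_symm k ρ₂ ▸ (by omega) : D.p k ρ₂ = 1)
      have m1 := D.p_sum hm α
      have m3 := hm.p_right ρ
      have m4 := hm.p_right β
      have m5 := D.p_symm β ρ₂
      obtain ⟨q, hq⟩ := exists_isSum_sub (D.p_symm m ρ ▸ (by omega) : D.p m ρ = 1)
      have q1 := D.p_sum hq α
      have q4 := hq.p_right β
      have q5 := D.p_symm β ρ
      rw [D.p_self] at k4
      have e : D.IsSum β q α := isSum_of_p (by omega) hβ (by omega)
      have : P.root ρ = P.root β + P.root β - P.root α - P.root ρ₁ - P.root ρ₂ := by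
        rw [hsub e, hsub hk, hsub hm, hsub hq]
        abel
      rw [this]
      exact sub_mem (sub_mem (sub_mem (add_mem (hmem _ (by simp)) (hmem _ (by simp)))
        (hmem _ (by simp))) (hmem _ (by simp))) (hmem _ (by simp))
    · push Not at hex
      refine ⟨ρ₁, h1α, h1β, fun ρ h h' => ?_⟩
      rw [hex ρ h h']
      exact subset_span (by simp)
  refine h4 α β ρ₁ ρ₂ (hcover _ (by simp) (by simp) ?_ hall hbad)
  rintro ρ (rfl | rfl | rfl | h)
  · exact .inl rfl
  · exact .inr (.inl rfl)
  · exact .inr (.inr ⟨h1α, h1β⟩)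
  · obtain rfl : ρ = ρ₂ := by simpa using h
    exact .inr (.inr ⟨h2α, h2β⟩)

end Irreducible

end GradedSteinberg

/-! ### Types A, D and E are ample. -/

namespace GradedSteinberg

section TypeADE

open Submodule RootCombinatorics

/-- The Dynkin diagram of `C` is connected. -/
def IsConnectedMatrix {l : ℕ} (C : Matrix (Fin l) (Fin l) ℤ) : Prop :=
  ∀ S : Fin l → Prop, (∃ i, S i) → (∀ i j, S i → C i j ≠ 0 → S j) → ∀ j, S j

/-- `par` describes a spanning tree of the Dynkin diagram: a set closed under adjacency descends to
the root `r` and climbs from there to every vertex. -/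
theorem isConnectedMatrix_of_tree {l : ℕ} {C : Matrix (Fin l) (Fin l) ℤ}
    (hC : C.IsSymm) (r : Fin l) (par : Fin l → Fin l) (ht : Fin l → ℕ)
    (hpar : ∀ i, i ≠ r → ht (par i) < ht i ∧ C i (par i) ≠ 0) : IsConnectedMatrix C := by
  intro S ⟨i, hi⟩ hS
  have down : ∀ n : ℕ, ∀ i, ht i = n → S i → S r := by
    intro n
    induction n using Nat.strong_induction_on with
    | _ n ih =>
      intro i hn h
      by_cases h0 : i = r
      · exact h0 ▸ h
      · obtain ⟨hlt, hne⟩ := hpar i h0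
        exact ih _ (hn ▸ hlt) _ rfl (hS _ _ h hne)
  have h0 := down _ i rfl hi
  have up : ∀ n : ℕ, ∀ i, ht i = n → S i := by
    intro n
    induction n using Nat.strong_induction_on with
    | _ n ih =>
      intro i hn
      by_cases h : i = r
      · exact h ▸ h0
      · obtain ⟨hlt, hne⟩ := hpar i h
        exact hS (par i) i (ih _ (hn ▸ hlt) _ rfl) (by rwa [hC.apply])
  exact fun j => up _ j rfl

theorem isConnectedMatrix_A (l : ℕ) : IsConnectedMatrix (CartanMatrix.A (l + 1)) := by
  refine isConnectedMatrix_of_tree (CartanMatrix.A_isSymm _) 0 (fun i => ⟨i.val - 1, by omega⟩)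
    (fun i => i.val) ?_
  intro i hi
  have hi' : i.val ≠ 0 := fun h => hi (Fin.ext h)
  refine ⟨by simp only; omega, ?_⟩
  simp only [CartanMatrix.A, Matrix.of_apply]
  grind

theorem isConnectedMatrix_D (l : ℕ) (hl : 3 ≤ l) : IsConnectedMatrix (CartanMatrix.D (l + 1)) := by
  refine isConnectedMatrix_of_tree (CartanMatrix.D_isSymm _) 0
    -- Both ends of the fork, `l - 1` and `l`, hang from `l - 2`.
    (fun i => ⟨if i.val = l then l - 2 else i.val - 1, by split_ifs <;> omega⟩)
    (fun i => i.val) ?_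
  intro i hi
  have hi' : i.val ≠ 0 := fun h => hi (Fin.ext h)
  refine ⟨by simp only; split_ifs <;> omega, ?_⟩
  simp only [CartanMatrix.D, Matrix.of_apply]
  grind

theorem isConnectedMatrix_E₆ : IsConnectedMatrix CartanMatrix.E₆ :=
  isConnectedMatrix_of_tree CartanMatrix.E₆_isSymm 3 ![2, 3, 3, 3, 3, 4] ![2, 1, 1, 0, 1, 2]
    (by decide)

theorem isConnectedMatrix_E₇ : IsConnectedMatrix CartanMatrix.E₇ :=
  isConnectedMatrix_of_tree CartanMatrix.E₇_isSymm 3 ![2, 3, 3, 3, 3, 4, 5]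
    ![2, 1, 1, 0, 1, 2, 3] (by decide)

theorem isConnectedMatrix_E₈ : IsConnectedMatrix CartanMatrix.E₈ :=
  isConnectedMatrix_of_tree CartanMatrix.E₈_isSymm 3 ![2, 3, 3, 3, 3, 4, 5, 6]
    ![2, 1, 1, 0, 1, 2, 3, 4] (by decide)

variable {ι K V W : Type*} [Finite ι] [Field K] [CharZero K] [AddCommGroup V] [Module K V]
  [AddCommGroup W] [Module K W] {P : RootPairing ι K V W} [P.IsRootSystem] [P.IsCrystallographic]
  [P.IsReduced] {l : ℕ} {C : Matrix (Fin l) (Fin l) ℤ}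

-- For an invariant form, adjacent simple roots have equal length because `C` is symmetric, hence
-- all simple roots do, and reflections carry this to all roots. Equal lengths make the pairing
-- symmetric.
omit [P.IsRootSystem] in
theorem HasCartanMatrix.pairingIn_symm (h : HasCartanMatrix P C) (hC : C.IsSymm)
    (hconn : IsConnectedMatrix C) (i j : ι) : P.pairingIn ℤ i j = P.pairingIn ℤ j i := by
  obtain ⟨b, e, he⟩ := h
  have : Fintype ι := Fintype.ofFinite ι
  let B := P.toInvariantForm
  have : Nonempty ι := ⟨i⟩
  obtain ⟨i₀, hi₀⟩ := b.support_nonempty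
  have hsimple : ∀ m : Fin l, B.form (P.root (e.symm m)) (P.root (e.symm m)) =
      B.form (P.root i₀) (P.root i₀) := by
    refine hconn _ ⟨e ⟨i₀, hi₀⟩, by simp⟩ fun m n hm hmn => ?_
    rw [← hm]
    have h1 := B.pairing_mul_eq_pairing_mul_swap (e.symm m) (e.symm n)
    have h2 : P.pairing (e.symm m) (e.symm n) = (C m n : K) := by
      have := he (e.symm m) (e.symm n)
      simp only [Equiv.apply_symm_apply] at this
      rw [← this, ← P.algebraMap_pairingIn ℤ]
      rfl
    have h3 : P.pairing (e.symm n) (e.symm m) = (C m n : K) := by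
      have := he (e.symm n) (e.symm m)
      simp only [Equiv.apply_symm_apply] at this
      rw [← hC.apply, ← this, ← P.algebraMap_pairingIn ℤ]
      rfl
    rw [h2, h3] at h1
    exact (mul_left_cancel₀ (Int.cast_ne_zero.2 hmn) h1).symm
  have hall : ∀ k, B.form (P.root k) (P.root k) = B.form (P.root i₀) (P.root i₀) := by
    intro k
    refine b.induction_reflect (p := fun k => B.form (P.root k) (P.root k) =
      B.form (P.root i₀) (P.root i₀)) k ?_ ?_ ?_
    · intro k hk
      simpa [P.root_reflectionPerm] using hk
    · intro k hk
      simpa using hsimple (e ⟨k, hk⟩)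
    · intro k m hk _
      simpa [P.root_reflectionPerm] using hk
  have h1 := B.pairing_mul_eq_pairing_mul_swap i j
  rw [hall i, hall j] at h1
  have h2 := mul_right_cancel₀ (B.ne_zero i₀) h1
  rw [← P.algebraMap_pairingIn ℤ, ← P.algebraMap_pairingIn ℤ] at h2
  exact ((algebraMap ℤ K).injective_int h2).symm

-- Some simple root lies in the span of `s`, since otherwise all of them would be orthogonal to
-- `i₀`. Lying in the span passes along the edges of the diagram: a simple root outside it is
-- orthogonal to all of it.
omit [P.IsReduced] [Finite ι] in
theorem HasCartanMatrix.isConnectedRoots (h : HasCartanMatrix P C)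
    (hconn : IsConnectedMatrix C) : IsConnectedRoots P := by
  obtain ⟨b, e, he⟩ := h
  rintro s ⟨i₀, hi₀⟩ hor
  set U := span K (P.root '' s)
  have htop : span K (P.root '' b.support) = ⊤ := by simp
  obtain ⟨i, hi⟩ : ∃ i : b.support, P.root i ∈ U := by
    by_contra! hno
    refine span_ne_top_of_forall_pairingIn_eq_zero (P := P) (s := b.support) (i := i₀)
      (fun j hj => ?_) htop
    rw [P.pairingIn_eq_zero_iff]
    exact (hor j).resolve_left (hno ⟨j, hj⟩) i₀ hi₀
  have hS := hconn (fun m => P.root (e.symm m) ∈ U) ⟨e i, by simpa⟩ (by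
    intro m n hm hmn
    by_contra hn
    refine hmn ?_
    have h1 := (hor (e.symm n)).resolve_left hn
    have hle : U ≤ LinearMap.ker (P.coroot' (e.symm n)) := by
      rw [span_le]
      rintro _ ⟨j, hj, rfl⟩
      have := congrArg (algebraMap ℤ K) (h1 j hj)
      rw [P.algebraMap_pairingIn, map_zero] at this
      simpa [P.root_coroot'_eq_pairing] using this
    have h2 := hle hm
    rw [LinearMap.mem_ker, P.root_coroot'_eq_pairing, ← P.algebraMap_pairingIn ℤ] at h2
    have h3 := he (e.symm m) (e.symm n)
    simp only [Equiv.apply_symm_apply] at h3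
    rw [← h3]
    exact (algebraMap ℤ K).injective_int (h2.trans (map_zero _).symm))
  rw [eq_top_iff, ← htop, span_le]
  rintro _ ⟨j, hj, rfl⟩
  simpa using hS (e ⟨j, hj⟩)

omit [P.IsReduced] [Finite ι] [CharZero K] in
theorem HasCartanMatrix.finrank_eq (h : HasCartanMatrix P C) : Module.finrank K V = l := by
  obtain ⟨b, e, -⟩ := h
  rw [Module.finrank_eq_card_basis (b.toWeightBasis.reindex e), Fintype.card_fin]

omit [P.IsReduced] [P.IsCrystallographic] [P.IsRootSystem] [Finite ι] [CharZero K] in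
theorem span_image_ne_top_of_card_lt (s : Finset ι) (hs : s.card < Module.finrank K V) :
    span K (P.root '' s) ≠ ⊤ := by
  classical
  intro h
  have h1 := finrank_span_finset_le_card (R := K) (s.image P.root)
  rw [Finset.coe_image, Set.finrank, h, finrank_top] at h1
  have := Finset.card_image_le (s := s) (f := P.root)
  omega

-- For a failing pair, `(α + ρ) / 2` is thus a vector of norm 1 with integral pairings. A root `σ`
-- with `p σ α = ±1` has `p σ ρ = ±1`, and one orthogonal to `α` is `±ρ` or orthogonal to `ρ`.
omit [P.IsRootSystem] in
theorem even_pairingIn_add (hs : ∀ i j, P.pairingIn ℤ i j = P.pairingIn ℤ j i) {α ρ : ι}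
    (hρ : P.pairingIn ℤ ρ α = 0) (hne : ∃ β, P.pairingIn ℤ β α = 1)
    (hbad : ∀ σ, P.pairingIn ℤ σ α = 1 → P.pairingIn ℤ σ ρ ≠ 0) (σ : ι) :
    Even (P.pairingIn ℤ α σ + P.pairingIn ℤ ρ σ) := by
  let D := rootCombinatorics hs
  change D.p ρ α = 0 at hρ
  change ∀ σ, D.p σ α = 1 → D.p σ ρ ≠ 0 at hbad
  rw [hs α, hs ρ]
  change Even (D.p σ α + D.p σ ρ)
  have hρ' := D.p_symm α ρ
  have hρρ := D.p_self ρ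
  have pos : ∀ σ, D.p σ α = 1 → D.p σ ρ = 1 ∨ D.p σ ρ = -1 := by
    intro σ h
    have h1 := hbad σ h
    have h2 := D.p_le σ ρ
    have h3 := D.neg_two_le σ ρ
    have h4 : D.p σ ρ ≠ 2 := fun h' => by rw [D.eq_of_p _ _ h'] at h; omega
    have h5 : D.p σ ρ ≠ -2 := fun h' => by rw [D.eq_neg_of_p h', D.p_neg] at h; omega
    omega
  have h2 := D.p_le σ α
  have h3 := D.neg_two_le σ α
  rw [Int.even_iff]
  rcases (by omega : D.p σ α = 2 ∨ D.p σ α = 1 ∨ D.p σ α = 0 ∨ D.p σ α = -1 ∨ D.p σ α = -2)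
    with h | h | h | h | h
  · have := D.eq_of_p _ _ h
    subst this
    omega
  · have := pos σ h
    omega
  · rcases p_eq_of_forall_p_ne_zero hρ hne hbad h with h' | rfl | rfl
    · omega
    · omega
    · rw [D.p_neg] at h ⊢
      rw [D.p_neg]
      omega
  · have := pos (D.neg σ) (by rw [D.p_neg]; omega)
    rw [D.p_neg] at this
    omega
  · have := D.eq_neg_of_p h
    subst this
    rw [D.p_neg] at h ⊢
    rw [D.p_neg]
    omega

omit [P.IsReduced] [P.IsRootSystem] [Finite ι] in
theorem exists_pairingIn_eq_sum (b : P.Base) (e : b.support ≃ Fin l) (i : ι) :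
    ∃ f : Fin l → ℤ, ∀ j, P.pairingIn ℤ i j = ∑ k, f k * P.pairingIn ℤ (e.symm k) j := by
  obtain ⟨f, -, -, hf⟩ := b.exists_root_eq_sum_int i
  refine ⟨fun k => f (e.symm k), fun j => (algebraMap ℤ K).injective_int ?_⟩
  rw [Equiv.sum_comp e.symm (fun x : b.support => f x * P.pairingIn ℤ x j),
    ← b.support.sum_subtype (f := fun x => f x * P.pairingIn ℤ x j) (by tauto)]
  simp_rw [map_sum, map_mul, P.algebraMap_pairingIn, ← P.root_coroot'_eq_pairing]
  simp [hf]

-- The Cartan matrix of `A₄` has determinant 5, which is odd, so a combination of simple roots with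
-- only even pairings has even coefficients. For a failing pair, `(α + ρ) / 2` would then lie in the
-- root lattice and have norm 1, but that lattice is even.
omit [P.IsRootSystem] in
theorem HasCartanMatrix.exists_orthogonal_of_A_four (h : HasCartanMatrix P (CartanMatrix.A 4))
    (hs : ∀ i j, P.pairingIn ℤ i j = P.pairingIn ℤ j i) (h1 : ∀ α, ∃ β, P.pairingIn ℤ β α = 1)
    (α ρ : ι) (hρ : P.pairingIn ℤ ρ α = 0) :
    ∃ σ, P.pairingIn ℤ σ α = 1 ∧ P.pairingIn ℤ σ ρ = 0 := by
  by_contra! hbad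
  have heven := even_pairingIn_add hs hρ (h1 α) hbad
  obtain ⟨b, e, he⟩ := h
  obtain ⟨f, hf⟩ := exists_pairingIn_eq_sum b e α
  obtain ⟨g, hg⟩ := exists_pairingIn_eq_sum b e ρ
  have hC : ∀ k m, P.pairingIn ℤ (e.symm k) (e.symm m) = CartanMatrix.A 4 k m := by
    intro k m
    have := he (e.symm k) (e.symm m)
    simpa [RootPairing.Base.cartanMatrixIn_def] using this
  have hsum : ∀ j, P.pairingIn ℤ α j + P.pairingIn ℤ ρ j =
      ∑ k, (f k + g k) * P.pairingIn ℤ (e.symm k) j := by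
    intro j
    rw [hf, hg, ← Finset.sum_add_distrib]
    exact Finset.sum_congr rfl fun k _ => (add_mul _ _ _).symm
  have hc : ∀ m, P.pairingIn ℤ α (e.symm m) + P.pairingIn ℤ ρ (e.symm m) =
      ∑ k, (f k + g k) * CartanMatrix.A 4 k m := by
    intro m
    simp_rw [hsum, hC]
  have htot : ∑ k, (f k + g k) *
      (P.pairingIn ℤ α (e.symm k) + P.pairingIn ℤ ρ (e.symm k)) = 4 := by
    have e1 := hsum α
    have e2 := hsum ρ
    have e3 := hs ρ α
    simp only [P.pairingIn_same] at e1 e2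
    simp_rw [mul_add, Finset.sum_add_distrib, hs α, hs ρ (e.symm _), ← e1, ← e2]
    omega
  have hev := fun m => heven (e.symm m)
  simp_rw [hc] at hev htot
  have v0 := hev 0
  have v1 := hev 1
  have v2 := hev 2
  have v3 := hev 3
  simp only [CartanMatrix.A, Matrix.of_apply, Fin.sum_univ_four] at v0 v1 v2 v3 htot
  generalize f 0 + g 0 = m0 at *
  generalize f 1 + g 1 = m1 at *
  generalize f 2 + g 2 = m2 at *
  generalize f 3 + g 3 = m3 at *
  simp at v0 v1 v2 v3 htot
  rw [Int.even_iff] at v0 v1 v2 v3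
  obtain ⟨k1, rfl⟩ : ∃ k, m1 = 2 * k := ⟨m1 / 2, by omega⟩
  obtain ⟨k3, rfl⟩ : ∃ k, m3 = 2 * k := ⟨m3 / 2, by omega⟩
  obtain ⟨k2, rfl⟩ : ∃ k, m2 = 2 * k := ⟨m2 / 2, by omega⟩
  obtain ⟨k0, rfl⟩ : ∃ k, m0 = 2 * k := ⟨m0 / 2, by omega⟩
  -- The left side is the norm of `(α + ρ) / 2` in simple coordinates, by `htot`.
  have : 2 * (k0 * k0 + k1 * k1 + k2 * k2 + k3 * k3 - k0 * k1 - k1 * k2 - k2 * k3) = 1 := by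
    linarith
  omega

theorem HasCartanMatrix.isAmple (h : HasCartanMatrix P C) (hsymm : C.IsSymm)
    (hconn : IsConnectedMatrix C) (hl : 4 ≤ l)
    (h4 : l = 4 → HasCartanMatrix P (CartanMatrix.A 4)) :
    ∃ hs : ∀ i j, P.pairingIn ℤ i j = P.pairingIn ℤ j i, (rootCombinatorics hs).IsAmple := by
  classical
  have hs := h.pairingIn_symm hsymm hconn
  have hirr := h.isConnectedRoots hconn
  have hrank := h.finrank_eq
  have h2 : ∀ a b, span K (P.root '' {a, b}) ≠ ⊤ := fun a b => by
    have := span_image_ne_top_of_card_lt (P := P) {a, b}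
      (by rw [hrank]; exact Finset.card_le_two.trans_lt (by omega))
    rwa [Finset.coe_insert, Finset.coe_singleton] at this
  have h1 := exists_pairingIn_eq_one hs hirr h2
  refine ⟨hs, h1, fun α ρ => exists_pairingIn_eq_one_and_eq_neg_one hs hirr,
    fun α β => exists_pairingIn_orthogonal hs hirr h2 ?_⟩
  rcases hl.eq_or_lt with rfl | hl
  · exact .inr ((h4 rfl).exists_orthogonal_of_A_four hs h1)
  · refine .inl fun a b c d => ?_
    have := span_image_ne_top_of_card_lt (P := P) {a, b, c, d}
      (by rw [hrank]; exact Finset.card_le_four.trans_lt (by omega))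
    rwa [Finset.coe_insert, Finset.coe_insert, Finset.coe_insert, Finset.coe_singleton] at this

theorem IsTypeADE.isAmple (hP : IsTypeADE P) :
    ∃ hs : ∀ i j, P.pairingIn ℤ i j = P.pairingIn ℤ j i, (rootCombinatorics hs).IsAmple := by
  rcases hP with ⟨l, hl, h⟩ | ⟨l, hl, h⟩ | h | h | h
  · obtain ⟨l, rfl⟩ : ∃ m, l = m + 1 := ⟨l - 1, by omega⟩
    exact h.isAmple (CartanMatrix.A_isSymm _) (isConnectedMatrix_A _) hl
      fun h' => by rw [h'] at h; exact h
  · obtain ⟨l, rfl⟩ : ∃ m, l = m + 1 := ⟨l - 1, by omega⟩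
    exact h.isAmple (CartanMatrix.D_isSymm _) (isConnectedMatrix_D _ (by omega)) (by omega)
      (by omega)
  · exact h.isAmple CartanMatrix.E₆_isSymm isConnectedMatrix_E₆ (by norm_num) (by norm_num)
  · exact h.isAmple CartanMatrix.E₇_isSymm isConnectedMatrix_E₇ (by norm_num) (by norm_num)
  · exact h.isAmple CartanMatrix.E₈_isSymm isConnectedMatrix_E₈ (by norm_num) (by norm_num)

end TypeADE

end GradedSteinberg

/-! ### Structure constants of a Chevalley basis. -/

namespace GradedSteinberg

/-- The properties of the structure constants of a Chevalley basis in the simply-laced case. -/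
structure RootCombinatorics.IsStructureConstants {ι : Type*} (D : RootCombinatorics ι)
    (N : ι → ι → ℤ) : Prop where
  sq : ∀ {i j k}, D.IsSum i j k → N i j * N i j = 1
  antisymm : ∀ {i j k}, D.IsSum i j k → N j i = -N i j
  jacobi : ∀ {ρ β' β γ κ α}, D.IsSum ρ β' β → D.IsSum ρ γ κ → D.p β' γ = 0 → D.IsSum β γ α →
    D.IsSum β' κ α → N ρ β' * N β γ = -(N ρ γ * N β' κ)

section ChevalleyBasis

variable {ι K V W L : Type*} [Finite ι] [Field K] [CharZero K] [AddCommGroup V] [Module K V]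
  [AddCommGroup W] [Module K W] {P : RootPairing ι K V W} [P.IsCrystallographic] [P.IsReduced]
  [LieRing L] [LieAlgebra K L] (𝓒 : ChevalleyBasis P L)
  (hs : ∀ i j, P.pairingIn ℤ i j = P.pairingIn ℤ j i)

include hs in
theorem add_notMem_range_root {i j : ι} (h : P.pairingIn ℤ i j ≠ -1) :
    P.root i + P.root j ∉ Set.range P.root := by
  rintro ⟨k, hk⟩
  exact h (RootCombinatorics.IsSum.p_eq (D := rootCombinatorics hs) hk).1

omit [P.IsReduced] in
theorem add_ne_zero {i j : ι} (h : P.pairingIn ℤ i j ≠ -2) : P.root i + P.root j ≠ 0 := by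
  intro h0
  exact h ((P.pairingIn_neg_two_neg_two_iff ℤ i j).2 (eq_neg_of_add_eq_zero_left h0)).1

omit [Finite ι] [P.IsCrystallographic] [P.IsReduced] in
theorem ChevalleyBasis.zsmul_e_injective {m n : ℤ} {k : ι} (h : m • 𝓒.e k = n • 𝓒.e k) :
    m = n := by
  have hk : 𝓒.e k ≠ 0 := 𝓒.e_linearIndependent.ne_zero k
  rw [← Int.cast_smul_eq_zsmul K, ← Int.cast_smul_eq_zsmul K] at h
  exact Int.cast_injective (smul_left_injective K hk h)

/-- Applying `ad e_{-i}` to `⁅e_i, e_j⁆` returns `e_j`, so `N i j` divides 1. The last property is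
the Jacobi identity for `ρ`, `β'`, `γ`, one term of which vanishes as `β' ⟂ γ`. -/
theorem ChevalleyBasis.isStructureConstants :
    (rootCombinatorics hs).IsStructureConstants 𝓒.N := by
  set D := rootCombinatorics hs with hD
  have hzero : ∀ {i j}, D.p i j = 0 ∨ D.p i j = 1 → ⁅𝓒.e i, 𝓒.e j⁆ = 0 := by
    intro i j h
    have h' : P.pairingIn ℤ i j = 0 ∨ P.pairingIn ℤ i j = 1 := h
    exact 𝓒.lie_e_eq_zero i j (add_ne_zero (by omega)) (add_notMem_range_root hs (by omega))
  have hadd : ∀ {i j k}, D.IsSum i j k → ⁅𝓒.e i, 𝓒.e j⁆ = 𝓒.N i j • 𝓒.e k :=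
    fun h => 𝓒.lie_e_add _ _ _ h
  refine ⟨?_, ?_, ?_⟩
  · intro i j k h
    have hp := h.p_eq
    have hnk : D.IsSum (D.neg i) k j := RootCombinatorics.isSum_of_p
      (by rw [D.p_neg]; omega) (by rw [D.p_neg]; omega) (by rw [D.p_symm]; omega)
    have h1 : ⁅𝓒.e (D.neg i), ⁅𝓒.e i, 𝓒.e j⁆⁆ = 𝓒.e j := by
      rw [leibniz_lie, hzero (i := D.neg i) (j := j) (by rw [D.p_neg]; omega), lie_zero, add_zero,
        𝓒.lie_e_neg (D.neg i) i (by
          change P.root i = -P.root (P.reflectionPerm i i)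
          rw [root_reflectionPerm_self, neg_neg]), 𝓒.lie_h_e]
      have : P.toLinearMap (P.root j) (P.coroot (D.neg i)) = 1 := by
        change P.pairing j (D.neg i) = 1
        rw [← P.algebraMap_pairingIn ℤ]
        change algebraMap ℤ K (D.p j (D.neg i)) = 1
        rw [D.p_neg_right, D.p_symm, hp.1]
        simp
      rw [this, one_smul]
    rw [hadd h, lie_zsmul, hadd hnk, smul_smul] at h1
    have h2 : 𝓒.N i j * 𝓒.N (D.neg i) k = 1 :=
      𝓒.zsmul_e_injective (k := j) (by rw [h1, one_smul])
    rcases Int.eq_one_or_neg_one_of_mul_eq_one h2 with h3 | h3 <;> rw [h3] <;> rfl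
  · intro i j k h
    refine 𝓒.zsmul_e_injective (k := k) ?_
    rw [← hadd h.symm, neg_smul, ← hadd h, lie_skew]
  · intro ρ β' β γ κ α h1 h2 h0 h3 h4
    refine 𝓒.zsmul_e_injective (k := α) ?_
    have e1 : ⁅⁅𝓒.e ρ, 𝓒.e β'⁆, 𝓒.e γ⁆ = (𝓒.N ρ β' * 𝓒.N β γ) • 𝓒.e α := by
      rw [hadd h1, zsmul_lie, hadd h3, smul_smul]
    have e2 : ⁅𝓒.e β', ⁅𝓒.e ρ, 𝓒.e γ⁆⁆ = (𝓒.N ρ γ * 𝓒.N β' κ) • 𝓒.e α := by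
      rw [hadd h2, lie_zsmul, hadd h4, smul_smul]
    rw [← e1, neg_smul, ← e2, lie_lie, hzero (.inl h0), lie_zero, zero_sub]

end ChevalleyBasis

end GradedSteinberg

/-! ### Commutator calculus and well-definedness in degree `n + 1`. -/

namespace GradedSteinberg

open scoped commutatorElement

section GroupIdentities

variable {G : Type*} [Group G]

theorem commute_commutator {z u v : G} (hu : Commute z u) (hv : Commute z v) : Commute z ⁅u, v⁆ := by
  rw [commutatorElement_def]
  exact ((hu.mul_right hv).mul_right hu.inv_right).mul_right hv.inv_right

theorem conj_commutator (z u v : G) : z * ⁅u, v⁆ * z⁻¹ = ⁅z * u * z⁻¹, z * v * z⁻¹⁆ := by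
  simp only [commutatorElement_def]
  group

theorem mul_eq_commutator_mul (z u : G) : z * u * z⁻¹ = ⁅z, u⁆ * u := by
  simp [commutatorElement_def]

theorem commute_iff_conj {z u : G} : Commute z u ↔ z * u * z⁻¹ = u := by
  rw [commute_iff_eq, mul_inv_eq_iff_eq_mul]

/-- The Hall–Witt identity, one of whose three factors is trivial because `s` and `g` commute. -/
theorem commutator_commutator_left {r s g : G} (h : Commute s g) :
    ⁅⁅r, s⁆, g⁆ = r * ⁅s, ⁅r⁻¹, g⁆⁆ * r⁻¹ := by
  have h' : s⁻¹ * g * s = g := by rw [mul_assoc, ← h.eq, inv_mul_cancel_left]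
  have h'' : g * s⁻¹ = s⁻¹ * g := h.inv_left.eq.symm
  calc ⁅⁅r, s⁆, g⁆ = r * s * r⁻¹ * (s⁻¹ * g * s) * r * s⁻¹ * r⁻¹ * g⁻¹ := by
        simp only [commutatorElement_def]; group
    _ = r * s * r⁻¹ * g * r * s⁻¹ * r⁻¹ * g⁻¹ := by rw [h']
    _ = r * s * r⁻¹ * g * r * (g⁻¹ * (g * s⁻¹)) * r⁻¹ * g⁻¹ := by group
    _ = r * s * r⁻¹ * g * r * (g⁻¹ * (s⁻¹ * g)) * r⁻¹ * g⁻¹ := by rw [h'']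
    _ = r * ⁅s, ⁅r⁻¹, g⁆⁆ * r⁻¹ := by simp only [commutatorElement_def]; group

/-- Conjugation by `z` replaces `u` by `w * u`, and `w` disappears from the commutator with `v`. -/
theorem commute_commutator_of_commutator_eq {z u v w : G} (h : ⁅z, u⁆ = w) (hv : Commute z v)
    (hwv : Commute w v) (hw : Commute w ⁅u, v⁆) : Commute z ⁅u, v⁆ := by
  rw [commute_iff_conj, conj_commutator, mul_eq_commutator_mul, h, commute_iff_conj.1 hv]
  rw [commute_iff_conj] at hw
  calc ⁅w * u, v⁆ = w * ⁅u, v⁆ * (v * w⁻¹) * v⁻¹ := by simp only [commutatorElement_def]; group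
    _ = w * ⁅u, v⁆ * (w⁻¹ * v) * v⁻¹ := by rw [hwv.inv_left.eq]
    _ = w * ⁅u, v⁆ * w⁻¹ := by group
    _ = ⁅u, v⁆ := hw

theorem commutator_mul_right_of_commute {u v w : G} (h : Commute v ⁅u, w⁆) :
    ⁅u, v * w⁆ = ⁅u, v⁆ * ⁅u, w⁆ := by
  rw [commute_iff_conj] at h
  rw [← h]
  simp only [commutatorElement_def]
  group

end GroupIdentities

/-- A graded ring `⨁ B d` with an element `t` of degree `1` such that multiplication by `t` is
injective and maps `B d` onto `B (d + 1)` for `d ≥ 0`. -/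
structure IsGradedBy {R : Type*} [CommRing R] (B : ℤ → AddSubgroup R) (t : R) : Prop where
  one_mem : 1 ∈ B 0
  mem : t ∈ B 1
  mul_mem : ∀ {d e : ℤ} {a b : R}, a ∈ B d → b ∈ B e → a * b ∈ B (d + e)
  exists_eq_mul : ∀ {d : ℤ} {c : R}, 0 ≤ d → c ∈ B (d + 1) → ∃ c' ∈ B d, c = t * c'
  mul_left_cancel : ∀ {a b : R}, t * a = t * b → a = b
  eq_zero : ∀ {d e : ℤ} {a : R}, a ∈ B d → a ∈ B e → d ≠ e → a = 0

namespace IsGradedBy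

variable {R : Type*} [CommRing R] {B : ℤ → AddSubgroup R} {t : R} (hB : IsGradedBy B t)
include hB

theorem pow_mem (k : ℕ) : t ^ k ∈ B k := by
  induction k with
  | zero => simpa using hB.one_mem
  | succ k ih =>
    rw [pow_succ]
    exact_mod_cast hB.mul_mem ih hB.mem

theorem exists_eq_pow_mul (k : ℕ) {d : ℤ} {c : R} (hd : 0 ≤ d) (hc : c ∈ B (d + k)) :
    ∃ c' ∈ B d, c = t ^ k * c' := by
  induction k generalizing c with
  | zero => exact ⟨c, by simpa using hc, by simp⟩
  | succ k ih =>
    obtain ⟨c₁, hc₁, rfl⟩ := hB.exists_eq_mul (d := d + k) (c := c) (by omega)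
      (by simpa [add_assoc] using hc)
    obtain ⟨c₂, hc₂, rfl⟩ := ih hc₁
    exact ⟨c₂, hc₂, by ring⟩

end IsGradedBy

/-- A family `x i a` of elements of a group, indexed by roots `i` and homogeneous `a`, satisfies the
Steinberg relations of degree at most `n`. -/
structure IsTruncFamily {ι R G : Type*} [CommRing R] [Group G] (D : RootCombinatorics ι)
    (N : ι → ι → ℤ) (B : ℤ → AddSubgroup R) (n : ℤ) (x : ι → R → G) : Prop where
  add : ∀ (i : ι) {d : ℤ} {a b : R}, d ≤ n → a ∈ B d → b ∈ B d → x i a * x i b = x i (a + b)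
  comm_add : ∀ {i j k : ι} {d e : ℤ} {a b : R}, D.IsSum i j k → d ≤ n → e ≤ n → d + e ≤ n →
    a ∈ B d → b ∈ B e → ⁅x i a, x j b⁆ = x k (N i j • (a * b))
  commute : ∀ {i j : ι} {d e : ℤ} {a b : R}, D.p i j = 0 ∨ D.p i j = 1 → d ≤ n → e ≤ n →
    a ∈ B d → b ∈ B e → Commute (x i a) (x j b)

open RootCombinatorics

/-- `ρ = β - β' = γ' - γ`; this is the configuration that `comm_eq_comm` requires. -/
theorem RootCombinatorics.IsSum.exists_sub {ι : Type*} {D : RootCombinatorics ι}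
    {α β γ β' γ' : ι} (h : D.IsSum β γ α) (h' : D.IsSum β' γ' α) (hp : D.p β β' = 1) :
    ∃ ρ, D.IsSum ρ β' β ∧ D.IsSum ρ γ γ' ∧ D.p β' γ = 0 := by
  obtain ⟨ρ, hρ⟩ := exists_isSum_sub hp
  have a1 := h.p_eq
  have a2 := h'.p_eq
  have a3 := hρ.p_eq
  have b1 := h.p_right β'
  have b2 := h'.p_right γ
  have b3 := h'.p_right ρ
  have b4 := D.p_sum hρ α
  have b5 := D.p_sum hρ γ
  have s1 := D.p_symm β β'
  have s2 := D.p_symm β' γ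
  have s3 := D.p_symm ρ β'
  exact ⟨ρ, hρ.symm, isSum_of_p (by omega) (by omega) (by omega), by omega⟩

/-- Take `β' = β - ρ` for a root `ρ` orthogonal to `α` and acute to `β`. -/
theorem RootCombinatorics.IsAmple.exists_adjacent {ι : Type*} {D : RootCombinatorics ι}
    (hD : D.IsAmple) {α β γ : ι} (h : D.IsSum β γ α) :
    ∃ β' γ', D.IsSum β' γ' α ∧ D.p β β' = 1 := by
  have a1 := h.p_eq
  obtain ⟨ρ, h1, h2, -⟩ := hD.exists_orthogonal α β a1.2.1
  have s1 := D.p_symm ρ β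
  obtain ⟨β', hβ'⟩ := exists_isSum_sub (by omega : D.p β ρ = 1)
  have b1 := D.p_sum hβ' α
  have b2 := hβ'.p_eq
  have s2 := D.p_symm β' α
  have s3 := D.p_symm β' β
  obtain ⟨γ', hγ'⟩ := exists_isSum_sub (by omega : D.p α β' = 1)
  exact ⟨β', γ', hγ', by omega⟩

namespace IsTruncFamily

variable {ι R G : Type*} [CommRing R] [Group G] {D : RootCombinatorics ι} {N : ι → ι → ℤ}
  {B : ℤ → AddSubgroup R} {t : R} {n : ℤ} {x : ι → R → G}

section Basic

variable (H : IsTruncFamily D N B n x)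
include H

theorem map_zero (i : ι) : x i 0 = 1 := by
  have := H.add i le_rfl (zero_mem (B n)) (zero_mem (B n))
  rw [add_zero] at this
  exact mul_eq_left.1 this

theorem map_neg (i : ι) {d : ℤ} {a : R} (hd : d ≤ n) (ha : a ∈ B d) : x i (-a) = (x i a)⁻¹ := by
  have := H.add i hd (neg_mem ha) ha
  rw [neg_add_cancel, H.map_zero] at this
  exact eq_inv_of_mul_eq_one_left this

variable (hB : IsGradedBy B t) (hN : D.IsStructureConstants N) (hD : D.IsAmple) (hn : 1 ≤ n)
include hB hN hD hn

/-- The new case is `i = j` with different degrees, on which the relations are silent: there `x i b`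
is a commutator of `x β 1` and `x γ (±b)`, whose roots are both acute to `i`. -/
theorem commute_of_nonneg {i j : ι} {d e : ℤ} {a b : R} (hp : 0 ≤ D.p i j) (hd : d ≤ n)
    (he : e ≤ n) (ha : a ∈ B d) (hb : b ∈ B e) : Commute (x i a) (x j b) := by
  have := D.p_le i j
  rcases (by omega : (D.p i j = 0 ∨ D.p i j = 1) ∨ D.p i j = 2) with h | h
  · exact H.commute h hd he ha hb
  obtain rfl := D.eq_of_p _ _ h
  obtain ⟨β, hβ⟩ := hD.exists_acute i
  rw [D.p_symm] at hβ
  obtain ⟨γ, hγ⟩ := exists_isSum_sub hβ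
  have h1 := H.comm_add hγ (by omega : 0 ≤ n) he (by omega) hB.one_mem
    ((B e).zsmul_mem hb (N β γ))
  rw [one_mul, smul_smul, hN.sq hγ, one_smul] at h1
  rw [← h1]
  have hq := hγ.p_eq
  exact commute_commutator (H.commute (.inr hβ) hd (by omega) ha hB.one_mem)
    (H.commute (.inr (by rw [D.p_symm]; omega)) hd he ha ((B e).zsmul_mem hb _))

theorem commute_comm {β γ δ : ι} {d e f : ℤ} {a b c : R} (hβ : 0 ≤ D.p δ β) (hγ : 0 ≤ D.p δ γ)
    (hd : d ≤ n) (he : e ≤ n) (hf : f ≤ n) (ha : a ∈ B d) (hb : b ∈ B e) (hc : c ∈ B f) :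
    Commute (x δ c) ⁅x β a, x γ b⁆ :=
  commute_commutator (H.commute_of_nonneg hB hN hD hn hβ hf hd hc ha)
    (H.commute_of_nonneg hB hN hD hn hγ hf he hc hb)

/-- Conjugation by `x δ c` multiplies `x β a` by an element for the root `δ + β`, which is
orthogonal to `γ` and acute to `β`. -/
theorem commute_comm_of_le {β γ δ : ι} {d e f : ℤ} {a b c : R} (hβγ : D.p β γ = -1)
    (hβ : D.p δ β = -1) (hγ : D.p δ γ = 1) (hd : d ≤ n) (he : e ≤ n) (hf : f ≤ n)
    (hfd : f + d ≤ n) (ha : a ∈ B d) (hb : b ∈ B e) (hc : c ∈ B f) :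
    Commute (x δ c) ⁅x β a, x γ b⁆ := by
  obtain ⟨k, hk⟩ := D.exists_isSum δ β hβ
  have h1 := D.p_sum hk γ
  have h2 := D.p_sum hk β
  rw [D.p_self] at h2
  have hw : N δ β • (c * a) ∈ B (f + d) := (B _).zsmul_mem (hB.mul_mem hc ha) _
  exact commute_commutator_of_commutator_eq (H.comm_add hk hf hd hfd hc ha)
    (H.commute (.inr hγ) hf he hc hb) (H.commute (.inl (by omega)) hfd he hw hb)
    (H.commute_comm hB hN hD hn (by omega) (by omega) hd he hfd ha hb hw)

/-- The factor `a₁` moves from the first entry to the second. The total degree `d₁ + d₂ + e` may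
exceed `n`; only the partial sums `d₁ + d₂` and `d₁ + e` are bounded. The conjugation by `x ρ a₁`
left by Hall–Witt acts trivially by `commute_comm_of_le`. -/
theorem comm_eq_comm {ρ β β' γ κ : ι} {d₁ d₂ e : ℤ} {a₁ a₂ b : R} (hβ : D.IsSum ρ β' β)
    (hκ : D.IsSum ρ γ κ) (hp : D.p β' γ = 0) (h₁ : d₁ ≤ n) (h₂ : d₂ ≤ n) (he : e ≤ n)
    (h₁₂ : d₁ + d₂ ≤ n) (h₁e : d₁ + e ≤ n) (ha₁ : a₁ ∈ B d₁) (ha₂ : a₂ ∈ B d₂) (hb : b ∈ B e) :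
    ⁅x β (N ρ β' • (a₁ * a₂)), x γ b⁆ = ⁅x β' a₂, x κ (-(N ρ γ • (a₁ * b)))⁆ := by
  rw [← H.comm_add hβ h₁ h₂ h₁₂ ha₁ ha₂,
    commutator_commutator_left (H.commute (.inl hp) h₂ he ha₂ hb), ← H.map_neg ρ h₁ ha₁,
    H.comm_add hκ h₁ he h₁e (neg_mem ha₁) hb, H.map_neg ρ h₁ ha₁, neg_mul, smul_neg,
    ← commute_iff_conj]
  have h1 := hβ.p_eq
  have h2 := hκ.p_eq
  have h3 := hκ.p_right β'
  have h4 := D.p_symm ρ β'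
  exact H.commute_comm_of_le hB hN hD hn (by omega) (by omega) (by omega) h₂ h₁e h₁ h₁₂ ha₂
    (neg_mem ((B _).zsmul_mem (hB.mul_mem ha₁ hb) _)) ha₁

theorem comm_map_add {α β γ : ι} {d e : ℤ} {a b b' : R} (h : D.IsSum β γ α) (hd : d ≤ n)
    (he : e ≤ n) (ha : a ∈ B d) (hb : b ∈ B e) (hb' : b' ∈ B e) :
    ⁅x β a, x γ (b + b')⁆ = ⁅x β a, x γ b⁆ * ⁅x β a, x γ b'⁆ := by
  rw [← H.add γ he hb hb']
  apply commutator_mul_right_of_commute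
  obtain ⟨β', γ', h', hp⟩ := hD.exists_adjacent h
  obtain ⟨ρ, h1, h2, h3⟩ := h.exists_sub h' hp
  -- Moving the factor 1 costs no degree and rewrites the commutator through `β'` and `γ'`, which
  -- are orthogonal and acute to `γ`.
  have key := H.comm_eq_comm hB hN hD hn h1 h2 h3 (by omega : 0 ≤ n) hd he (by omega) (by omega)
    hB.one_mem ((B d).zsmul_mem ha (N ρ β')) hb'
  rw [one_mul, smul_smul, hN.sq h1, one_smul, one_mul] at key
  rw [key]
  have q1 := h2.p_eq
  have q2 := D.p_symm γ β'
  exact H.commute_comm hB hN hD hn (by omega) (by omega) hd he he ((B _).zsmul_mem ha _)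
    (neg_mem ((B _).zsmul_mem hb' _)) hb

theorem comm_map_neg {α β γ : ι} {d e : ℤ} {a b : R} (h : D.IsSum β γ α) (hd : d ≤ n)
    (he : e ≤ n) (ha : a ∈ B d) (hb : b ∈ B e) : ⁅x β a, x γ (-b)⁆ = ⁅x β a, x γ b⁆⁻¹ := by
  have := H.comm_map_add hB hN hD hn h hd he ha (neg_mem hb) hb
  rw [neg_add_cancel, H.map_zero, commutatorElement_one_right] at this
  exact eq_inv_of_mul_eq_one_left this.symm

/-- A normal form: write `a = t * a'`, keep `t` at `β'` and move `a'` to `γ'`. As `d + e = n + 1`,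
the moved product has degree exactly `n`. -/
theorem comm_eq_comm_t {α β γ β' γ' : ι} {d e : ℤ} {a b c : R} (h : D.IsSum β γ α)
    (h' : D.IsSum β' γ' α) (hp : D.p β β' = 1) (hd : 1 ≤ d) (he : 1 ≤ e) (hde : d + e = n + 1)
    (ha : a ∈ B d) (hb : b ∈ B e) (hc : N β' γ' • (t * c) = N β γ • (a * b)) :
    ⁅x β a, x γ b⁆ = ⁅x β' t, x γ' c⁆ := by
  obtain ⟨ρ, h1, h2, h3⟩ := h.exists_sub h' hp
  obtain ⟨a', ha', rfl⟩ := hB.exists_eq_mul (d := d - 1) (c := a) (by omega) (by simpa using ha)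
  have key := H.comm_eq_comm hB hN hD hn h1 h2 h3 (by omega) hn (by omega) (by omega)
    (by omega) ((B (d - 1)).zsmul_mem ha' (N ρ β')) hB.mem hb
  have sq1 := hN.sq h1
  have sq2 := hN.sq h'
  have jac := hN.jacobi h1 h2 h3 h h'
  have e1 : N ρ β' • (N ρ β' • a' * t) = t * a' := by
    rw [smul_mul_assoc, smul_smul, sq1, one_smul, mul_comm]
  have e2 : -(N ρ γ • (N ρ β' • a' * b)) = c := by
    have key : -(N ρ γ * N ρ β') = N β' γ' * N β γ := by
      linear_combination N ρ γ * N ρ β' * sq2 + N β' γ' * N β γ * sq1 -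
        N ρ β' * N β' γ' * jac
    refine hB.mul_left_cancel ?_
    replace hc := congrArg (N β' γ' • ·) hc
    simp only [smul_smul, sq2, one_smul, ← key] at hc
    rw [hc, smul_mul_assoc, smul_smul, ← neg_smul, mul_smul_comm, mul_assoc]
  rwa [e1, e2] at key

/-- Both sides have the same normal form on an adjacent decomposition of `α`. -/
theorem comm_eq_of_smul_eq_same {α β γ : ι} {d e d' e' : ℤ} {a b a' b' : R}
    (h : D.IsSum β γ α) (hd : 1 ≤ d) (he : 1 ≤ e) (hde : d + e = n + 1)
    (hd' : 1 ≤ d') (he' : 1 ≤ e') (hde' : d' + e' = n + 1) (ha : a ∈ B d) (hb : b ∈ B e)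
    (ha' : a' ∈ B d') (hb' : b' ∈ B e') (hab : a * b = a' * b') :
    ⁅x β a, x γ b⁆ = ⁅x β a', x γ b'⁆ := by
  obtain ⟨β₂, γ₂, h₂, hp⟩ := hD.exists_adjacent h
  obtain ⟨a₀, ha₀, rfl⟩ := hB.exists_eq_mul (d := d - 1) (c := a) (by omega) (by simpa using ha)
  have hc : N β₂ γ₂ • (t * (N β₂ γ₂ • N β γ • (a₀ * b))) = N β γ • (t * a₀ * b) := by
    rw [mul_smul_comm, smul_smul, hN.sq h₂, one_smul, mul_smul_comm, mul_assoc]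
  rw [H.comm_eq_comm_t hB hN hD hn h h₂ hp hd he hde ha hb hc,
    H.comm_eq_comm_t hB hN hD hn h h₂ hp hd' he' hde' ha' hb' (hc.trans (by rw [hab]))]

theorem comm_eq_of_smul_eq_of_pos {α β γ β' γ' : ι} {d e d' e' : ℤ} {a b a' b' : R}
    (h : D.IsSum β γ α) (h' : D.IsSum β' γ' α) (hp : 1 ≤ D.p β β') (hd : 1 ≤ d) (he : 1 ≤ e)
    (hde : d + e = n + 1) (hd' : 1 ≤ d') (he' : 1 ≤ e') (hde' : d' + e' = n + 1) (ha : a ∈ B d)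
    (hb : b ∈ B e) (ha' : a' ∈ B d') (hb' : b' ∈ B e')
    (hab : N β γ • (a * b) = N β' γ' • (a' * b')) : ⁅x β a, x γ b⁆ = ⁅x β' a', x γ' b'⁆ := by
  have := D.p_le β β'
  rcases (by omega : D.p β β' = 1 ∨ D.p β β' = 2) with hp | hp
  · obtain ⟨a₀, ha₀, rfl⟩ := hB.exists_eq_mul (d := d' - 1) (c := a') (by omega)
      (by simpa using ha')
    rw [H.comm_eq_comm_t hB hN hD hn h h' hp hd he hde ha hb (c := a₀ * b')
      (by rw [hab, mul_assoc])]
    exact H.comm_eq_of_smul_eq_same hB hN hD hn h' le_rfl hn (by omega) hd' he' hde' hB.mem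
      (by simpa [show d' - 1 + e' = n by omega] using hB.mul_mem ha₀ hb') ha' hb' (by ring)
  · obtain rfl := D.eq_of_p _ _ hp
    have hγ : γ = γ' := by
      have q1 := h.p_eq
      have q2 := h'.p_eq
      have q3 := h.p_right γ'
      have q4 := D.p_symm β γ'
      have q5 := D.p_symm γ γ'
      exact D.eq_of_p _ _ (by omega)
    subst hγ
    refine H.comm_eq_of_smul_eq_same hB hN hD hn h hd he hde hd' he' hde' ha hb ha' hb' ?_
    have := congrArg (N β γ • ·) hab
    simpa only [smul_smul, hN.sq h, one_smul] using this

/-- Since `β` pairs to 1 with `α = β' + γ'`, it has positive pairing with `β'` or with `γ'`. In the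
second case the entries are exchanged, and the sign is absorbed by antisymmetry of `N`. -/
theorem comm_eq_of_smul_eq {α β γ β' γ' : ι} {d e d' e' : ℤ} {a b a' b' : R}
    (h : D.IsSum β γ α) (h' : D.IsSum β' γ' α) (hd : 1 ≤ d) (he : 1 ≤ e)
    (hde : d + e = n + 1) (hd' : 1 ≤ d') (he' : 1 ≤ e') (hde' : d' + e' = n + 1) (ha : a ∈ B d)
    (hb : b ∈ B e) (ha' : a' ∈ B d') (hb' : b' ∈ B e')
    (hab : N β γ • (a * b) = N β' γ' • (a' * b')) : ⁅x β a, x γ b⁆ = ⁅x β' a', x γ' b'⁆ := by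
  by_cases hp : 1 ≤ D.p β β'
  · exact H.comm_eq_of_smul_eq_of_pos hB hN hD hn h h' hp hd he hde hd' he' hde' ha hb ha' hb' hab
  · have q1 := h.p_eq
    have q2 := h'.p_right β
    rw [← commutatorElement_inv (x γ' b'), ← H.comm_map_neg hB hN hD hn h'.symm
      (by omega) (by omega) hb' ha']
    refine H.comm_eq_of_smul_eq_of_pos hB hN hD hn h h'.symm (by omega) hd he hde he' hd'
      (by omega) ha hb hb' (neg_mem ha') ?_
    rw [hab, hN.antisymm h', mul_neg, smul_neg, neg_smul, neg_neg, mul_comm]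

end Basic

end IsTruncFamily

end GradedSteinberg

/-! ### Extension of a family from level `n` to level `n + 1`. -/

namespace GradedSteinberg

open scoped commutatorElement
open RootCombinatorics

namespace IsTruncFamily

variable {ι R G : Type*} [CommRing R] [Group G] {D : RootCombinatorics ι} {N : ι → ι → ℤ}
  {B : ℤ → AddSubgroup R} {t : R} {n : ℤ} {x : ι → R → G}

/-- The elements `x i a` with `a` of degree `n + 1` are the commutators of the elements of
positive degree. -/
def IsTop (D : RootCombinatorics ι) (N : ι → ι → ℤ) (B : ℤ → AddSubgroup R) (n : ℤ)
    (x : ι → R → G) : Prop :=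
  ∀ {α β γ : ι} {d e : ℤ} {a b : R}, D.IsSum β γ α → 1 ≤ d → 1 ≤ e → d + e = n + 1 →
    a ∈ B d → b ∈ B e → ⁅x β a, x γ b⁆ = x α (N β γ • (a * b))

section Top

variable (H : IsTruncFamily D N B n x) (hB : IsGradedBy B t) (hN : D.IsStructureConstants N)
  (hD : D.IsAmple) (hn : 1 ≤ n)
include H hB hN hD hn

open Classical in
/-- A family of level `n` can be changed in degree `n + 1` so that it becomes a family of
commutators there. -/
theorem exists_isTop : ∃ y : ι → R → G, IsTruncFamily D N B n y ∧ IsTop D N B n y ∧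
    ∀ (i : ι) (d : ℤ) (a : R), d ≤ n → a ∈ B d → y i a = x i a := by
  have hdec : ∀ α, ∃ β γ, D.IsSum β γ α := by
    intro α
    obtain ⟨β, hβ⟩ := hD.exists_acute α
    rw [D.p_symm] at hβ
    exact ⟨β, exists_isSum_sub hβ⟩
  -- `Z α c` is the common value of all these commutators, or 1 if there are none.
  have hZ : ∀ (α : ι) (c : R), ∃ z : G, ∀ (β γ : ι) (d e : ℤ) (a b : R), D.IsSum β γ α → 1 ≤ d →
      1 ≤ e → d + e = n + 1 → a ∈ B d → b ∈ B e → N β γ • (a * b) = c → ⁅x β a, x γ b⁆ = z := by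
    intro α c
    by_cases hex : ∃ (β γ : ι) (d e : ℤ) (a b : R), D.IsSum β γ α ∧ 1 ≤ d ∧
      1 ≤ e ∧ d + e = n + 1 ∧ a ∈ B d ∧ b ∈ B e ∧ N β γ • (a * b) = c
    · obtain ⟨β, γ, d, e, a, b, h, hd, he, hde, ha, hb, hab⟩ := hex
      refine ⟨⁅x β a, x γ b⁆, fun β' γ' d' e' a' b' h' hd' he' hde' ha' hb' hab' => ?_⟩
      exact H.comm_eq_of_smul_eq hB hN hD hn h' h hd' he' hde' hd he hde ha' hb' ha hb
        (hab'.trans hab.symm)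
    · refine ⟨1, fun β γ d e a b h hd he hde ha hb hab => ?_⟩
      exact absurd ⟨β, γ, d, e, a, b, h, hd, he, hde, ha, hb, hab⟩ hex
  choose Z hZ using hZ
  have hZ0 : ∀ α, Z α 0 = 1 := by
    intro α
    obtain ⟨β, γ, h⟩ := hdec α
    rw [← hZ α 0 β γ 1 n t 0 h le_rfl hn (by omega) hB.mem (zero_mem _) (by simp), H.map_zero,
      commutatorElement_one_right]
  let y : ι → R → G := fun i a => if ∃ d ≤ n, a ∈ B d then x i a else Z i a
  have hy : ∀ (i : ι) (d : ℤ) (a : R), d ≤ n → a ∈ B d → y i a = x i a :=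
    fun i d a hd ha => if_pos ⟨d, hd, ha⟩
  have hyZ : ∀ (i : ι) (a : R), a ∈ B (n + 1) → y i a = Z i a := by
    intro i a ha
    by_cases hex : ∃ d ≤ n, a ∈ B d
    · obtain ⟨d, hd, had⟩ := hex
      obtain rfl := hB.eq_zero ha had (by omega)
      -- Only 0 has both degree `n + 1` and a smaller degree, and there the two definitions agree.
      rw [hy i d 0 hd had, H.map_zero, hZ0]
    · exact if_neg hex
  refine ⟨y, ⟨?_, ?_, ?_⟩, ?_, hy⟩
  · intro i d a b hd ha hb
    rw [hy i d a hd ha, hy i d b hd hb, hy i d _ hd (add_mem ha hb), H.add i hd ha hb]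
  · intro i j k d e a b h hd he hde ha hb
    rw [hy i d a hd ha, hy j e b he hb,
      hy k _ _ hde ((B _).zsmul_mem (hB.mul_mem ha hb) _), H.comm_add h hd he hde ha hb]
  · intro i j d e a b hp hd he ha hb
    rw [hy i d a hd ha, hy j e b he hb]
    exact H.commute hp hd he ha hb
  · intro α β γ d e a b h hd he hde ha hb
    rw [hy β d a (by omega) ha, hy γ e b (by omega) hb,
      hyZ α _ (hde ▸ (B _).zsmul_mem (hB.mul_mem ha hb) _)]
    exact hZ _ _ _ _ _ _ _ _ h hd he hde ha hb rfl

variable (T : IsTop D N B n x)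
include T

omit H hD in
theorem exists_eq_comm {α β γ : ι} (h : D.IsSum β γ α) {c : R} (hc : c ∈ B (n + 1)) :
    ∃ c' ∈ B n, x α c = ⁅x β t, x γ c'⁆ := by
  obtain ⟨c₀, hc₀, rfl⟩ := hB.exists_eq_mul (by omega) hc
  refine ⟨N β γ • c₀, (B n).zsmul_mem hc₀ _, ?_⟩
  rw [T h le_rfl hn (by omega) hB.mem ((B n).zsmul_mem hc₀ _), mul_smul_comm, smul_smul, hN.sq h,
    one_smul]

theorem add_top (i : ι) {a b : R} (ha : a ∈ B (n + 1)) (hb : b ∈ B (n + 1)) :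
    x i a * x i b = x i (a + b) := by
  obtain ⟨β, hβ⟩ := hD.exists_acute i
  rw [D.p_symm] at hβ
  obtain ⟨γ, h⟩ := exists_isSum_sub hβ
  have key : ∀ c ∈ B n, ⁅x β t, x γ (N β γ • c)⁆ = x i (t * c) := by
    intro c hc
    rw [T h le_rfl hn (by omega) hB.mem ((B n).zsmul_mem hc _), mul_smul_comm, smul_smul, hN.sq h,
      one_smul]
  obtain ⟨a₀, ha₀, rfl⟩ := hB.exists_eq_mul (by omega) ha
  obtain ⟨b₀, hb₀, rfl⟩ := hB.exists_eq_mul (by omega) hb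
  rw [← mul_add, ← key _ (add_mem ha₀ hb₀), ← key _ ha₀, ← key _ hb₀, smul_add,
    H.comm_map_add hB hN hD hn h hn le_rfl hB.mem ((B n).zsmul_mem ha₀ _)
      ((B n).zsmul_mem hb₀ _)]

/-- The decomposition `α = δ + γ` is unsuitable; an adjacent one has parts acute and orthogonal to
`δ`. -/
theorem commute_top_of_pos {δ α : ι} {e : ℤ} {b c : R} (hp : D.p δ α = 1) (he : e ≤ n)
    (hb : b ∈ B e) (hc : c ∈ B (n + 1)) : Commute (x δ b) (x α c) := by
  have hp' := D.p_symm α δ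
  obtain ⟨γ, h⟩ := exists_isSum_sub (by omega : D.p α δ = 1)
  obtain ⟨β', γ', h', hq⟩ := hD.exists_adjacent h
  obtain ⟨c', hc', hcomm⟩ := exists_eq_comm hB hN hn T h' hc
  rw [hcomm]
  have := h'.p_right δ
  exact H.commute_comm hB hN hD hn (by omega) (by omega) hn le_rfl he hB.mem hc' hb

/-- Here `α = σ + (α - σ)` has both parts orthogonal to `δ`. -/
theorem commute_top_of_orthogonal {δ α σ : ι} {e : ℤ} {b c : R} (hp : D.p δ α = 0)
    (hσ : D.p σ α = 1) (hσδ : D.p σ δ = 0) (he : e ≤ n)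
    (hb : b ∈ B e) (hc : c ∈ B (n + 1)) : Commute (x δ b) (x α c) := by
  have hp' := D.p_symm α σ
  obtain ⟨γ, h⟩ := exists_isSum_sub (by omega : D.p α σ = 1)
  obtain ⟨c', hc', hcomm⟩ := exists_eq_comm hB hN hn T h hc
  rw [hcomm]
  have := h.p_right δ
  have := D.p_symm σ δ
  exact H.commute_comm hB hN hD hn (by omega) (by omega) hn le_rfl he hB.mem hc' hb

/-- Split `α = μ + ν` with `μ ⟂ ε` and `x α a = ⁅x μ t, x ν _⁆`. Hall–Witt turns the left side into
a commutator for `ν + (μ + δ) = ε`, conjugated by `x μ t`, which commutes with the result. -/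
theorem comm_top {α δ ε : ι} {e : ℤ} {a b : R} (h : D.IsSum α δ ε) (he : e ≤ 0)
    (ha : a ∈ B (n + 1)) (hb : b ∈ B e) : ⁅x α a, x δ b⁆ = x ε (N α δ • (a * b)) := by
  have h1 := h.p_eq
  obtain ⟨μ, hμε, hμα, σ, hσε, hσμ⟩ := hD.exists_orthogonal ε α h1.2.1
  have h2 := D.p_symm μ α
  obtain ⟨ν, hν⟩ := exists_isSum_sub (by omega : D.p α μ = 1)
  have h3 := hν.p_eq
  have h4 := h.p_right μ
  have h5 := D.p_sum hν δ
  have h6 := h.p_right ν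
  obtain ⟨κ, hκ⟩ := D.exists_isSum μ δ (by omega)
  have h7 := hκ.p_eq
  have h8 := hκ.p_right ν
  have h9 := D.p_symm μ ν
  have h10 := D.p_sum hκ ε
  have hνκ : D.IsSum ν κ ε := isSum_of_p (by omega) (by omega) (by omega)
  have jac := hN.jacobi hν hκ (by omega) h hνκ
  obtain ⟨a₀, ha₀, rfl⟩ := hB.exists_eq_mul (by omega) ha
  have hμν : ⁅x μ t, x ν (N μ ν • a₀)⁆ = x α (t * a₀) := by
    rw [T hν le_rfl hn (by omega) hB.mem ((B n).zsmul_mem ha₀ _), mul_smul_comm, smul_smul,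
      hN.sq hν, one_smul]
  have hw : N μ δ • (-t * b) ∈ B (1 + e) := (B _).zsmul_mem (hB.mul_mem (neg_mem hB.mem) hb) _
  have heq : N ν κ • (N μ ν • a₀ * N μ δ • (-t * b)) = N α δ • (t * a₀ * b) := by
    have sq1 := congrArg (Int.cast : ℤ → R) (hN.sq hν)
    replace jac := congrArg (Int.cast : ℤ → R) jac
    push_cast at jac sq1
    simp only [zsmul_eq_mul]
    linear_combination (-(N μ ν * a₀ * t * b : R)) * jac + (N α δ * a₀ * t * b : R) * sq1
  rw [← hμν, commutator_commutator_left (H.commute (.inl (by omega)) le_rfl (by omega)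
    ((B n).zsmul_mem ha₀ _) hb), ← H.map_neg μ hn hB.mem,
    H.comm_add hκ hn (by omega) (by omega) (neg_mem hB.mem) hb, H.map_neg μ hn hB.mem]
  -- For `e = 0` the result again has degree `n + 1`, so commuting past it needs the root `σ`; for
  -- `e < 0` everything stays in level `n`.
  rcases eq_or_lt_of_le he with rfl | he
  · rw [T hνκ hn (by omega : 1 ≤ 1 + (0 : ℤ)) (by omega) ((B n).zsmul_mem ha₀ _) hw, heq,
      ← commute_iff_conj]
    refine H.commute_top_of_orthogonal hB hN hD hn T hμε hσε hσμ hn hB.mem ?_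
    simpa using (B _).zsmul_mem (hB.mul_mem ha hb) _
  · rw [H.comm_add hνκ le_rfl (by omega) (by omega) ((B n).zsmul_mem ha₀ _) hw, heq,
      ← commute_iff_conj]
    exact H.commute (.inl hμε) hn (by omega : n + 1 + e ≤ n) hB.mem
      ((B _).zsmul_mem (hB.mul_mem ha hb) _)

theorem add_succ (i : ι) {d : ℤ} {a b : R} (hd : d ≤ n + 1) (ha : a ∈ B d) (hb : b ∈ B d) :
    x i a * x i b = x i (a + b) := by
  rcases eq_or_lt_of_le hd with rfl | hd
  · exact H.add_top hB hN hD hn T i ha hb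
  · exact H.add i (by omega) ha hb

theorem map_neg_succ (i : ι) {d : ℤ} {a : R} (hd : d ≤ n + 1) (ha : a ∈ B d) :
    x i (-a) = (x i a)⁻¹ := by
  have := H.add_succ hB hN hD hn T i hd (neg_mem ha) ha
  rw [neg_add_cancel, H.map_zero] at this
  exact eq_inv_of_mul_eq_one_left this

theorem comm_add_succ {i j k : ι} {d e : ℤ} {a b : R} (h : D.IsSum i j k) (hd : d ≤ n + 1)
    (he : e ≤ n + 1) (hde : d + e ≤ n + 1) (ha : a ∈ B d) (hb : b ∈ B e) :
    ⁅x i a, x j b⁆ = x k (N i j • (a * b)) := by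
  rcases eq_or_lt_of_le hd with rfl | hd
  · exact H.comm_top hB hN hD hn T h (by omega) ha hb
  rcases eq_or_lt_of_le he with rfl | he
  · rw [← commutatorElement_inv, H.comm_top hB hN hD hn T h.symm (by omega) hb ha,
      ← H.map_neg_succ hB hN hD hn T k (by omega : n + 1 + d ≤ n + 1)
        ((B _).zsmul_mem (hB.mul_mem hb ha) _), hN.antisymm h, neg_smul, neg_neg, mul_comm]
  rcases eq_or_lt_of_le hde with hde | hde
  · exact T h (by omega) (by omega) hde ha hb
  · exact H.comm_add h (by omega) (by omega) (by omega) ha hb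

/-- `α = (ρ + β') + γ = β' + (ρ + γ)`. Hall–Witt with `x ρ u`, `x β' _`, `x γ 1` equates `x α (u *
a)` with its own conjugate by `x ρ u`. -/
theorem commute_mul_top {ρ α : ι} {f : ℤ} {u a : R} (hp : D.p α ρ = 0) (hf : 1 ≤ f)
    (hf' : f ≤ n + 1) (hu : u ∈ B f) (ha : a ∈ B (n + 1 - f)) :
    Commute (x ρ u) (x α (u * a)) := by
  obtain ⟨β', h1, h2⟩ := hD.exists_acute_obtuse α ρ hp
  have s1 := D.p_symm ρ β'
  obtain ⟨β, hβ⟩ := D.exists_isSum ρ β' (by omega)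
  have h3 := hβ.p_right α
  have s2 := D.p_symm β' α
  obtain ⟨γ, hγ⟩ := exists_isSum_sub (by omega : D.p α β = 1)
  have h4 := hγ.p_right ρ
  have h5 := hβ.p_eq
  have s3 := D.p_symm ρ α
  have h6 := hγ.p_right β'
  have h7 := hγ.p_eq
  obtain ⟨κ, hκ⟩ := D.exists_isSum ρ γ (by omega)
  have h8 := hκ.p_right β'
  have h9 := D.p_sum hκ α
  have hα : D.IsSum β' κ α := isSum_of_p (by omega) (by omega) (by omega)
  have jac := hN.jacobi hβ hκ (by omega) hγ hα
  have hs : N ρ β' • N β γ • a ∈ B (n + 1 - f) := (B _).zsmul_mem ((B _).zsmul_mem ha _) _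
  have key := commutator_commutator_left (r := x ρ u) (s := x β' (N ρ β' • N β γ • a))
    (g := x γ 1) (H.commute (.inl (by omega)) (by omega) (by omega) hs hB.one_mem)
  have hua : N ρ β' • (u * N ρ β' • N β γ • a) ∈ B (n + 1) := by
    have := (B _).zsmul_mem (hB.mul_mem hu hs) (N ρ β')
    rwa [show f + (n + 1 - f) = n + 1 by omega] at this
  have hu1 : N ρ γ • (-u * 1) ∈ B f := by
    have := (B _).zsmul_mem (hB.mul_mem (neg_mem hu) hB.one_mem) (N ρ γ)
    rwa [add_zero] at this
  rw [H.comm_add_succ hB hN hD hn T hβ hf' (by omega) (by omega) hu hs,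
    H.comm_add_succ hB hN hD hn T hγ le_rfl (by omega : (0 : ℤ) ≤ n + 1) (by omega) hua hB.one_mem,
    ← H.map_neg_succ hB hN hD hn T ρ hf' hu,
    H.comm_add_succ hB hN hD hn T hκ hf' (by omega : (0 : ℤ) ≤ n + 1) (by omega) (neg_mem hu)
      hB.one_mem,
    H.comm_add_succ hB hN hD hn T hα (by omega) hf' (by omega) hs hu1,
    H.map_neg_succ hB hN hD hn T ρ hf' hu] at key
  have sq1 := congrArg (Int.cast : ℤ → R) (hN.sq hβ)
  have sq2 := congrArg (Int.cast : ℤ → R) (hN.sq hγ)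
  replace jac := congrArg (Int.cast : ℤ → R) jac
  push_cast at jac sq1 sq2
  have e1 : N β γ • (N ρ β' • (u * N ρ β' • N β γ • a) * 1) = u * a := by
    simp only [zsmul_eq_mul]
    linear_combination (N β γ * N β γ * u * a : R) * sq1 + (u * a) * sq2
  have e2 : N β' κ • (N ρ β' • N β γ • a * N ρ γ • (-u * 1)) = u * a := by
    simp only [zsmul_eq_mul]
    linear_combination (-(N ρ β' * N β γ * u * a : R)) * jac +
      (N β γ * N β γ * u * a : R) * sq1 + (u * a) * sq2
  rw [e1, e2] at key
  exact commute_iff_conj.2 key.symm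

/-- Write `x ρ c` as a commutator for `δ₁ + δ₂` with `t ^ k` at `δ₁`, where `δ₁` is acute and `δ₂`
obtuse to `α`. Then `x α a` fixes `x δ₁` and multiplies `x δ₂` by an element of degree `n + 1` at `ε
= α + δ₂`. This one commutes with `x δ₁ (t ^ k)` by `commute_mul_top`, being divisible by `t ^ k`,
and with `x ρ c` because `ε` is acute to `ρ`. -/
theorem commute_top_of_acute {ρ α : ι} {f : ℤ} {a c : R} (hp : D.p α ρ = 0)
    (hf : f = n ∨ f = n + 1)
    (hacute : ∀ (i j : ι) (a b : R), D.p i j = 1 → a ∈ B (n + 1) → b ∈ B f →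
      Commute (x i a) (x j b))
    (ha : a ∈ B (n + 1)) (hc : c ∈ B f) : Commute (x α a) (x ρ c) := by
  obtain ⟨k, hk⟩ : ∃ k : ℕ, f = k := ⟨f.toNat, by omega⟩
  have hu : t ^ k ∈ B f := hk ▸ hB.pow_mem k
  obtain ⟨σ, h1, h2⟩ := hD.exists_acute_obtuse α ρ hp
  obtain ⟨δ₁, hδ₁⟩ := D.exists_isSum σ ρ h2
  have h3 := D.p_sum hδ₁ α
  have s1 := D.p_symm α ρ
  have h4 := hδ₁.p_eq
  obtain ⟨δ₂, hδ₂⟩ := exists_isSum_sub h4.2.2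
  have h5 := hδ₂.p_right α
  have s2 := D.p_symm α δ₁
  obtain ⟨ε, hε⟩ := D.exists_isSum α δ₂ (by omega)
  have h6 := hε.p_right δ₁
  have h7 := hδ₂.p_eq
  have h8 := D.p_sum hε ρ
  have s3 := D.p_symm ε δ₁
  obtain ⟨c₀, hc₀, rfl⟩ := hB.exists_eq_pow_mul k (d := 0) (c := c) le_rfl
    (by rwa [zero_add, ← hk])
  have hρ : ⁅x δ₁ (t ^ k), x δ₂ (N δ₁ δ₂ • c₀)⁆ = x ρ (t ^ k * c₀) := by
    rw [H.comm_add_succ hB hN hD hn T hδ₂ (by omega) (by omega) (by omega) hu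
      ((B 0).zsmul_mem hc₀ _), mul_smul_comm, smul_smul, hN.sq hδ₂, one_smul]
  have hw : N α δ₂ • (a * N δ₁ δ₂ • c₀) ∈ B (n + 1) := by
    have := (B _).zsmul_mem (hB.mul_mem ha ((B 0).zsmul_mem hc₀ (N δ₁ δ₂))) (N α δ₂)
    rwa [add_zero] at this
  have hcomm := H.comm_add_succ hB hN hD hn T hε le_rfl (by omega : (0 : ℤ) ≤ n + 1) (by omega) ha
    ((B 0).zsmul_mem hc₀ (N δ₁ δ₂))
  have hwδ : Commute (x ε (N α δ₂ • (a * N δ₁ δ₂ • c₀))) (x δ₁ (t ^ k)) := by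
    obtain ⟨w₀, hw₀, hw₀'⟩ := hB.exists_eq_pow_mul k (d := n + 1 - f) (by omega)
      (by rwa [← hk, sub_add_cancel] : _ ∈ B (n + 1 - f + k))
    rw [hw₀']
    exact (H.commute_mul_top hB hN hD hn T (by omega) (by omega) (by omega) hu hw₀).symm
  have hwρ := hacute ε ρ _ _ (by omega) hw hc
  rw [← hρ] at hwρ ⊢
  rw [← commutatorElement_inv] at hwρ ⊢
  exact (commute_commutator_of_commutator_eq hcomm (hacute _ _ _ _ (by omega) ha hu) hwδ
    (by simpa using hwρ.inv_right)).inv_right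

/-- Below degree `n` there is room to move one factor `t`, so `commute_comm_of_le` suffices; degree
`n` itself needs `commute_top_of_acute`. -/
theorem commute_top_of_zero {ρ α : ι} {f : ℤ} {a c : R} (hp : D.p α ρ = 0) (hf : f ≤ n)
    (ha : a ∈ B (n + 1)) (hc : c ∈ B f) : Commute (x α a) (x ρ c) := by
  rcases eq_or_lt_of_le hf with rfl | hf
  · refine H.commute_top_of_acute hB hN hD hn T hp (.inl rfl) ?_ ha hc
    intro i j a b hij ha hb
    exact (H.commute_top_of_pos hB hN hD hn T (by rw [D.p_symm]; omega) le_rfl hb ha).symm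
  · obtain ⟨σ, h1, h2⟩ := hD.exists_acute_obtuse α ρ hp
    have s1 := D.p_symm α σ
    obtain ⟨γ, hγ⟩ := exists_isSum_sub (by omega : D.p α σ = 1)
    obtain ⟨a', ha', hcomm⟩ := exists_eq_comm hB hN hn T hγ ha
    rw [hcomm]
    have h3 := hγ.p_right ρ
    have s2 := D.p_symm ρ σ
    have s3 := D.p_symm ρ α
    exact (H.commute_comm_of_le hB hN hD hn hγ.p_eq.1 (by omega) (by omega) hn le_rfl hf.le
      (by omega) hB.mem ha' hc).symm

/-- `δ = ρ + μ` with `ρ` orthogonal and `μ` acute to `α`; both entries have degree at most `n`. -/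
theorem commute_top_top_of_one {δ α : ι} {a c : R} (hp : D.p δ α = 1)
    (ha : a ∈ B (n + 1)) (hc : c ∈ B (n + 1)) : Commute (x α a) (x δ c) := by
  obtain ⟨ρ, h1, h2, -⟩ := hD.exists_orthogonal α δ hp
  have s1 := D.p_symm δ ρ
  have s2 := D.p_symm α ρ
  obtain ⟨μ, hμ⟩ := exists_isSum_sub (by omega : D.p δ ρ = 1)
  obtain ⟨c', hc', hcomm⟩ := exists_eq_comm hB hN hn T hμ hc
  rw [hcomm]
  have h3 := D.p_sum hμ α
  exact commute_commutator (H.commute_top_of_zero hB hN hD hn T (by omega) hn ha hB.mem)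
    (H.commute_top_of_pos hB hN hD hn T (by omega) le_rfl hc' ha).symm

theorem succ_of_isTop : IsTruncFamily D N B (n + 1) x where
  add i := fun hd ha hb => H.add_succ hB hN hD hn T i hd ha hb
  comm_add := fun h hd he hde ha hb => H.comm_add_succ hB hN hD hn T h hd he hde ha hb
  commute := by
    have top : ∀ {i j : ι} {e : ℤ} {a b : R}, D.p i j = 0 ∨ D.p i j = 1 → e ≤ n + 1 →
        a ∈ B (n + 1) → b ∈ B e → Commute (x i a) (x j b) := by
      intro i j e a b hp he ha hb
      rcases eq_or_lt_of_le he with rfl | he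
      · rcases hp with hp | hp
        · refine H.commute_top_of_acute hB hN hD hn T hp (.inr rfl) ?_ ha hb
          exact fun i j a b hij ha hb =>
            H.commute_top_top_of_one hB hN hD hn T (by rw [D.p_symm]; omega) ha hb
        · exact H.commute_top_top_of_one hB hN hD hn T (by rw [D.p_symm]; omega) ha hb
      · rcases hp with hp | hp
        · exact H.commute_top_of_zero hB hN hD hn T hp (by omega) ha hb
        · exact (H.commute_top_of_pos hB hN hD hn T (by rw [D.p_symm]; omega) (by omega) hb
            ha).symm
    intro i j d e a b hp hd he ha hb
    rcases eq_or_lt_of_le hd with rfl | hd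
    · exact top hp he ha hb
    rcases eq_or_lt_of_le he with rfl | he
    · exact (top (by rw [D.p_symm]; exact hp) (by omega) hb ha).symm
    · exact H.commute hp (by omega) (by omega) ha hb

omit T in
/-- A family of level `n ≥ 1` extends to a family of level `n + 1`. -/
theorem exists_succ : ∃ y : ι → R → G, IsTruncFamily D N B (n + 1) y ∧
    ∀ (i : ι) (d : ℤ) (a : R), d ≤ n → a ∈ B d → y i a = x i a := by
  obtain ⟨y, hy, hT, hyx⟩ := H.exists_isTop hB hN hD hn
  exact ⟨y, hy.succ_of_isTop hB hN hD hn hT, hyx⟩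

end Top

end IsTruncFamily

end GradedSteinberg

/-! ### The graded ring `B` and families in all degrees. -/

namespace GradedSteinberg

open scoped commutatorElement LaurentPolynomial
open RootCombinatorics

section Ring

variable {A : Type*} [CommRing A] {M : Ideal A}

theorem mem_homB_iff {d : ℤ} {a : ringB M} :
    a ∈ homB M d ↔ ∀ e, e ≠ d → (a : A[T;T⁻¹]).coeff e = 0 := by
  change (a : A[T;T⁻¹]) ∈ AddMonoidAlgebra.grade A d ↔ _
  rw [AddMonoidAlgebra.mem_grade_iff, Finsupp.support_subset_singleton]
  constructor
  · intro h e he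
    rw [h, Finsupp.single_eq_of_ne he]
  · intro h
    ext e
    by_cases he : e = d
    · simp [he]
    · rw [h e he, Finsupp.single_eq_of_ne he]

theorem homB_mul_mem {d e : ℤ} {a b : ringB M} (ha : a ∈ homB M d) (hb : b ∈ homB M e) :
    a * b ∈ homB M (d + e) := by
  have h := SetLike.mul_mem_graded (A := AddMonoidAlgebra.grade A (M := ℤ))
    (show (a : A[T;T⁻¹]) ∈ _ from ha) (show (b : A[T;T⁻¹]) ∈ _ from hb)
  exact h

variable (M) in
/-- The element `t` of `B`. -/
noncomputable def tB : ringB M :=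
  ⟨LaurentPolynomial.T 1, fun d hd => by
    rw [LaurentPolynomial.T, AddMonoidAlgebra.coeff_single, Finsupp.single_eq_of_ne (by omega)]
    exact M.zero_mem⟩

theorem isGradedBy_homB : IsGradedBy (homB M) (tB M) where
  one_mem := by
    change (1 : A[T;T⁻¹]) ∈ AddMonoidAlgebra.grade A (0 : ℤ)
    exact SetLike.one_mem_graded _
  mem := AddMonoidAlgebra.single_mem_grade _ _
  mul_mem := homB_mul_mem
  exists_eq_mul := by
    intro d c hd hc
    rw [mem_homB_iff] at hc
    have hcoeff : ∀ e, (LaurentPolynomial.T (-1) * (c : A[T;T⁻¹])).coeff e =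
        (c : A[T;T⁻¹]).coeff (e + 1) := by
      intro e
      rw [LaurentPolynomial.T, AddMonoidAlgebra.coeff_single_mul_apply, one_mul]
      congr 1
      ring
    refine ⟨⟨LaurentPolynomial.T (-1) * (c : A[T;T⁻¹]), fun e he => ?_⟩, mem_homB_iff.2 fun e he => ?_, ?_⟩
    · rw [hcoeff, hc _ (by omega)]
      exact M.zero_mem
    · exact (hcoeff e).trans (hc _ (by omega))
    · ext1
      change (c : A[T;T⁻¹]) = LaurentPolynomial.T 1 *
        (LaurentPolynomial.T (-1) * (c : A[T;T⁻¹]))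
      rw [← mul_assoc, ← LaurentPolynomial.T_add]
      simp
  mul_left_cancel := by
    intro a b h
    have h' : LaurentPolynomial.T 1 * (a : A[T;T⁻¹]) = LaurentPolynomial.T 1 * (b : A[T;T⁻¹]) :=
      congrArg Subtype.val h
    exact Subtype.ext ((LaurentPolynomial.isUnit_T 1).mul_left_cancel h')
  eq_zero := by
    intro d e a ha hb hde
    rw [mem_homB_iff] at ha hb
    ext f
    by_cases hf : f = d
    · exact hb f (by omega)
    · exact ha f hf

/-- The homogeneous component of degree `d` of an element of `B`. -/
noncomputable def componentB (d : ℤ) (f : ringB M) : ringB M :=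
  ⟨AddMonoidAlgebra.single d ((f : A[T;T⁻¹]).coeff d), fun e he => by
    rw [AddMonoidAlgebra.coeff_single]
    by_cases h : e = d
    · subst h
      simpa using f.2 e he
    · rw [Finsupp.single_eq_of_ne h]
      exact M.zero_mem⟩

theorem componentB_mem (d : ℤ) (f : ringB M) : componentB d f ∈ homB M d :=
  AddMonoidAlgebra.single_mem_grade _ _

theorem componentB_add (d : ℤ) (f g : ringB M) :
    componentB d (f + g) = componentB d f + componentB d g := by
  ext1
  simp [componentB]

theorem componentB_of_mem {d e : ℤ} {a : ringB M} (ha : a ∈ homB M d) :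
    componentB e a = if e = d then a else 0 := by
  rw [mem_homB_iff] at ha
  split_ifs with h
  · subst h
    ext f
    change (AddMonoidAlgebra.single e ((a : A[T;T⁻¹]).coeff e)).coeff f = _
    rw [AddMonoidAlgebra.coeff_single]
    by_cases hf : f = e
    · subst hf
      exact Finsupp.single_eq_same
    · rw [ha f hf, Finsupp.single_eq_of_ne hf]
  · ext1
    simp [componentB, ha e h]

theorem componentB_eq_zero {d : ℤ} {f : ringB M} (h : d ∉ (f : A[T;T⁻¹]).coeff.support) :
    componentB d f = 0 := by
  ext1
  simp [componentB, Finsupp.notMem_support_iff.1 h]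

theorem sum_componentB (f : ringB M) :
    ∑ d ∈ (f : A[T;T⁻¹]).coeff.support, componentB d f = f := by
  ext1
  rw [AddSubmonoidClass.coe_finsetSum]
  apply AddMonoidAlgebra.ext
  rw [AddMonoidAlgebra.coeff_sum]
  exact Finsupp.sum_single _

theorem homB_induction {p : ringB M → Prop} (hom : ∀ (d : ℤ) (a : ringB M), a ∈ homB M d → p a)
    (add : ∀ a b, p a → p b → p (a + b)) (f : ringB M) : p f := by
  rw [← sum_componentB f]
  exact Finset.sum_induction _ p add (hom 0 0 (zero_mem _)) fun d _ => hom d _ (componentB_mem d f)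

/-- A map on homogeneous elements that is additive in each degree and has commuting values extends
to an additive map. -/
theorem exists_additive_extension {G : Type*} [Group G] (z : ringB M → G)
    (add : ∀ (d : ℤ) (a b : ringB M), a ∈ homB M d → b ∈ homB M d → z (a + b) = z a * z b)
    (comm : ∀ (d e : ℤ) (a b : ringB M), a ∈ homB M d → b ∈ homB M e → Commute (z a) (z b)) :
    ∃ y : ringB M → G, (∀ f g, y (f + g) = y f * y g) ∧
      ∀ (d : ℤ) (a : ringB M), a ∈ homB M d → y a = z a := by
  let S : Set G := {g | ∃ d a, a ∈ homB M d ∧ z a = g}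
  have hS := Subgroup.isMulCommutative_closure (k := S) (by
    rintro _ ⟨d, a, ha, rfl⟩ _ ⟨e, b, hb, rfl⟩
    exact comm d e a b ha hb)
  -- The values generate a commutative subgroup, in which the product over all degrees makes sense.
  let _ : CommGroup (Subgroup.closure S) :=
    { (inferInstance : Group (Subgroup.closure S)) with mul_comm := hS.is_comm.comm }
  have hz0 : z 0 = 1 := by
    have := add 0 0 0 (zero_mem _) (zero_mem _)
    rw [add_zero] at this
    exact left_eq_mul.1 this
  let g : ringB M → ℤ → Subgroup.closure S := fun f d =>
    ⟨z (componentB d f), Subgroup.subset_closure ⟨d, _, componentB_mem d f, rfl⟩⟩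
  have hfin : ∀ f, (Function.mulSupport (g f)).Finite := by
    intro f
    refine (Finset.finite_toSet (f : A[T;T⁻¹]).coeff.support).subset fun d hd => ?_
    by_contra h
    refine hd (Subtype.ext ?_)
    change z (componentB d f) = 1
    rw [componentB_eq_zero h, hz0]
  refine ⟨fun f => (∏ᶠ d, g f d : Subgroup.closure S), fun f f' => ?_, fun d a ha => ?_⟩
  · have : ∏ᶠ d, g (f + f') d = (∏ᶠ d, g f d) * ∏ᶠ d, g f' d := by
      rw [← finprod_mul_distrib (hfin f) (hfin f')]
      refine finprod_congr fun d => Subtype.ext ?_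
      change z (componentB d (f + f')) = z (componentB d f) * z (componentB d f')
      rw [componentB_add, add d _ _ (componentB_mem d f) (componentB_mem d f')]
    exact congrArg Subtype.val this
  · have : ∏ᶠ e, g a e = g a d := by
      refine finprod_eq_single _ _ fun e he => Subtype.ext ?_
      change z (componentB e a) = 1
      rw [componentB_of_mem ha, if_neg he, hz0]
    refine (congrArg Subtype.val this).trans ?_
    change z (componentB d a) = z a
    rw [componentB_of_mem ha, if_pos rfl]

end Ring

namespace IsTruncFamily

variable {ι R G : Type*} [CommRing R] [Group G] {D : RootCombinatorics ι} {N : ι → ι → ℤ}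
  {B : ℤ → AddSubgroup R} {t : R} {x : ι → R → G}

theorem congr {n : ℤ} {y : ι → R → G} (H : IsTruncFamily D N B n x) (hB : IsGradedBy B t)
    (h : ∀ (i : ι) (d : ℤ) (a : R), d ≤ n → a ∈ B d → y i a = x i a) :
    IsTruncFamily D N B n y where
  add i d a b hd ha hb := by
    rw [h i d a hd ha, h i d b hd hb, h i d _ hd (add_mem ha hb), H.add i hd ha hb]
  comm_add {i j k d e a b} hs hd he hde ha hb := by
    rw [h i d a hd ha, h j e b he hb,
      h k _ _ hde ((B _).zsmul_mem (hB.mul_mem ha hb) _), H.comm_add hs hd he hde ha hb]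
  commute {i j d e a b} hp hd he ha hb := by
    rw [h i d a hd ha, h j e b he hb]
    exact H.commute hp hd he ha hb

open Classical in
/-- A family of level `1` extends to all degrees. -/
theorem exists_forall (H : IsTruncFamily D N B 1 x) (hB : IsGradedBy B t)
    (hN : D.IsStructureConstants N) (hD : D.IsAmple) :
    ∃ y : ι → R → G, (∀ k : ℕ, IsTruncFamily D N B (k + 1) y) ∧
      ∀ (i : ι) (d : ℤ) (a : R), d ≤ 1 → a ∈ B d → y i a = x i a := by
  have step : ∀ (k : ℕ) (u : {u : ι → R → G // IsTruncFamily D N B (k + 1) u}),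
      ∃ v : {v : ι → R → G // IsTruncFamily D N B ((k + 1 : ℕ) + 1) v},
        ∀ (i : ι) (d : ℤ) (a : R), d ≤ k + 1 → a ∈ B d → v.1 i a = u.1 i a := by
    intro k u
    obtain ⟨v, hv, h⟩ := u.2.exists_succ hB hN hD (by omega)
    exact ⟨⟨v, by exact_mod_cast hv⟩, h⟩
  choose next hnext using step
  let F : (k : ℕ) → {u : ι → R → G // IsTruncFamily D N B (k + 1) u} :=
    fun k => Nat.rec ⟨x, by simpa using H⟩ next k
  have hF : ∀ k m : ℕ, k ≤ m → ∀ (i : ι) (d : ℤ) (a : R), d ≤ k + 1 → a ∈ B d →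
      (F m).1 i a = (F k).1 i a := by
    intro k m hkm i d a hd ha
    induction m, hkm using Nat.le_induction with
    | base => rfl
    | succ m hm ih => exact (hnext m (F m) i d a (by omega) ha).trans ih
  -- Stage `F k` has level `k + 1`. The stages agree where they overlap, so the chosen degree of `a`
  -- is immaterial.
  let y : ι → R → G := fun i a =>
    if h : ∃ d, a ∈ B d then (F (Classical.choose h).toNat).1 i a else 1
  have hy : ∀ (m : ℕ) (i : ι) (d : ℤ) (a : R), d ≤ m + 1 → a ∈ B d → y i a = (F m).1 i a := by
    intro m i d a hd ha
    have hex : ∃ d, a ∈ B d := ⟨d, ha⟩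
    have h1 : y i a = (F (Classical.choose hex).toNat).1 i a := dif_pos hex
    have h2 := Classical.choose_spec hex
    rw [h1]
    rcases le_total m (Classical.choose hex).toNat with h | h
    · exact hF _ _ h i d a hd ha
    · exact (hF _ _ h i _ a (by omega) h2).symm
  exact ⟨y, fun k => (F k).2.congr hB (hy k), fun i d a hd ha => hy 0 i d a (by simpa using hd) ha⟩

end IsTruncFamily

end GradedSteinberg

/-! ### Homomorphisms from families, and bijectivity. -/

namespace GradedSteinberg

open scoped commutatorElement
open RootCombinatorics

theorem commutator_mul_left_of_commute {G : Type*} [Group G] {u v w : G}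
    (h : Commute u ⁅w, v⁆) : ⁅u * w, v⁆ = ⁅w, v⁆ * ⁅u, v⁆ := by
  rw [commute_iff_conj] at h
  rw [← h]
  simp only [commutatorElement_def]
  group

theorem commutatorElement_mem {G : Type*} [Group G] {H : Subgroup G} {u v : G} (hu : u ∈ H)
    (hv : v ∈ H) : ⁅u, v⁆ ∈ H :=
  H.mul_mem (H.mul_mem (H.mul_mem hu hv) (H.inv_mem hu)) (H.inv_mem hv)

section Families

variable {ι K V W A G : Type*} [Finite ι] [Field K] [CharZero K] [AddCommGroup V] [Module K V]
  [AddCommGroup W] [Module K W] {P : RootPairing ι K V W} [P.IsCrystallographic] [P.IsReduced]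
  {N : ι → ι → ℤ} [CommRing A] {M : Ideal A} [Group G]
  (hs : ∀ i j, P.pairingIn ℤ i j = P.pairingIn ℤ j i)

include hs in
theorem sub_mem_range_root_iff {i j : ι} :
    P.root i - P.root j ∈ Set.range P.root ↔ P.pairingIn ℤ i j = 1 := by
  let D := rootCombinatorics hs
  constructor
  · rintro ⟨k, hk⟩
    have h : D.IsSum j k i := show P.root i = P.root j + P.root k by rw [hk]; abel
    have := h.p_eq.2.1
    rw [D.p_symm] at this
    exact this
  · intro h
    obtain ⟨k, hk⟩ := exists_isSum_sub (D := D) h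
    exact ⟨k, (sub_eq_of_eq_add' hk).symm⟩

/-- A family satisfying the relations of degree at most `n` defines a homomorphism from the
truncated Steinberg group. -/
theorem exists_hom_of_isTruncFamily {n : ℤ} {y : ι → ringB M → G}
    (H : IsTruncFamily (rootCombinatorics hs) N (homB M) n y) :
    ∃ ψ : TruncSteinberg P N M n →* G,
      ∀ (i : ι) (a : HomCoeff M n), ψ (TruncSteinberg.x P N M i a) = y i a.1 := by
  refine ⟨PresentedGroup.toGroup (f := fun g : ι × HomCoeff M n => y g.1 g.2.1) ?_,
    fun i a => PresentedGroup.toGroup.of _⟩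
  rintro r (hr : TruncRel P N M n r)
  cases hr with
  | add i d hd a b c ha hb hc =>
    simp only [map_mul, map_inv, FreeGroup.lift_apply_of]
    rw [H.add i hd ha hb, hc, mul_inv_cancel]
  | comm_add i j k hk d e hd he hde a b c ha hb hc =>
    simp only [map_mul, map_inv, map_commutatorElement, FreeGroup.lift_apply_of]
    rw [H.comm_add hk hd he hde ha hb, hc, mul_inv_cancel]
  | comm_acute i j h d e hd he a b ha hb =>
    simp only [map_commutatorElement, FreeGroup.lift_apply_of]
    exact commutatorElement_eq_one_iff_commute.2
      (H.commute (.inr ((sub_mem_range_root_iff hs).1 h)) hd he ha hb)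
  | comm_orthogonal i j h d e hd he a b ha hb =>
    simp only [map_commutatorElement, FreeGroup.lift_apply_of]
    exact commutatorElement_eq_one_iff_commute.2
      (H.commute (.inl (isOrthogonal_iff_pairingIn.1 h)) hd he ha hb)

open Classical in
variable (P N M) in
/-- The generators of the truncated Steinberg group as a family indexed by all elements of `B`. -/
noncomputable def truncFamily (n : ℤ) (i : ι) (a : ringB M) : TruncSteinberg P N M n :=
  if h : ∃ d : ℤ, d ≤ n ∧ a ∈ homB M d then TruncSteinberg.x P N M i ⟨a, h⟩ else 1

omit [Finite ι] [CharZero K] [P.IsCrystallographic] [P.IsReduced] in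
theorem truncFamily_eq {n : ℤ} (i : ι) (a : HomCoeff M n) :
    truncFamily P N M n i a.1 = TruncSteinberg.x P N M i a :=
  dif_pos a.2

theorem isTruncFamily_truncFamily (n : ℤ) :
    IsTruncFamily (rootCombinatorics hs) N (homB M) n (truncFamily P N M n) := by
  have key : ∀ {s : FreeGroup (ι × HomCoeff M n)}, TruncRel P N M n s →
      PresentedGroup.mk {r | TruncRel P N M n r} s = 1 := fun h => PresentedGroup.one_of_mem h
  have hx : ∀ {d : ℤ} {a : ringB M} (hd : d ≤ n) (ha : a ∈ homB M d) (i : ι),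
      truncFamily P N M n i a = PresentedGroup.mk {r | TruncRel P N M n r}
        (FreeGroup.of (i, ⟨a, d, hd, ha⟩)) := fun hd ha i => truncFamily_eq i ⟨_, _, hd, ha⟩
  refine ⟨?_, ?_, ?_⟩
  · intro i d a b hd ha hb
    rw [hx hd ha, hx hd hb, hx hd (add_mem ha hb)]
    have := key (.add i d hd ⟨a, d, hd, ha⟩ ⟨b, d, hd, hb⟩ ⟨a + b, d, hd, add_mem ha hb⟩ ha hb rfl)
    rwa [map_mul, map_mul, map_inv, mul_inv_eq_one] at this
  · intro i j k d e a b hk hd he hde ha hb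
    have hab : N i j • (a * b) ∈ homB M (d + e) :=
      (homB M _).zsmul_mem (homB_mul_mem ha hb) _
    rw [hx hd ha, hx he hb, hx hde hab]
    have := key (.comm_add i j k hk d e hd he hde ⟨a, d, hd, ha⟩ ⟨b, e, he, hb⟩
      ⟨_, d + e, hde, hab⟩ ha hb rfl)
    rwa [map_mul, map_commutatorElement, map_inv, mul_inv_eq_one] at this
  · intro i j d e a b hp hd he ha hb
    rw [hx hd ha, hx he hb, ← commutatorElement_eq_one_iff_commute, ← map_commutatorElement]
    rcases hp with hp | hp
    · exact key (.comm_orthogonal i j (isOrthogonal_iff_pairingIn.2 hp) d e hd he _ _ ha hb)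
    · exact key (.comm_acute i j ((sub_mem_range_root_iff hs).2 hp) d e hd he _ _ ha hb)

theorem isTruncFamily_steinberg (n : ℤ) :
    IsTruncFamily (rootCombinatorics hs) N (homB M) n (Steinberg.x P N (S := ringB M)) := by
  have key : ∀ {s : FreeGroup (ι × ringB M)}, SteinbergRel P N (ringB M) s →
      PresentedGroup.mk {r | SteinbergRel P N (ringB M) r} s = 1 :=
    fun h => PresentedGroup.one_of_mem h
  refine ⟨?_, ?_, ?_⟩
  · intro i d a b _ _ _
    have := key (.add i a b)
    rwa [map_mul, map_mul, map_inv, mul_inv_eq_one] at this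
  · intro i j k d e a b hk _ _ _ _ _
    have := key (.comm_add i j k a b hk)
    rwa [map_mul, map_commutatorElement, map_inv, mul_inv_eq_one] at this
  · intro i j d e a b hp _ _ _ _
    replace hp : P.pairingIn ℤ i j = 0 ∨ P.pairingIn ℤ i j = 1 := hp
    have := key (.comm_one i j a b (add_ne_zero (by omega)) (add_notMem_range_root hs (by omega)))
    rw [map_commutatorElement] at this
    exact commutatorElement_eq_one_iff_commute.1 this

/-- A family of elements satisfying the relations of all degrees defines a homomorphism from the
Steinberg group. -/
theorem exists_hom_of_forall_isTruncFamily {y : ι → ringB M → G}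
    (hN : (rootCombinatorics hs).IsStructureConstants N) (hD : (rootCombinatorics hs).IsAmple)
    (H : ∀ k : ℕ, IsTruncFamily (rootCombinatorics hs) N (homB M) (k + 1) y) :
    ∃ ψ : Steinberg P N (ringB M) →* G,
      ∀ (i : ι) (d : ℤ) (a : ringB M), a ∈ homB M d → ψ (Steinberg.x P N i a) = y i a := by
  set D := rootCombinatorics hs with hDdef
  have hcomm : ∀ {i j : ι} {d e : ℤ} {a b : ringB M}, 0 ≤ D.p i j → a ∈ homB M d → b ∈ homB M e →
      Commute (y i a) (y j b) := fun {i j d e a b} hp ha hb =>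
    (H (max d.toNat e.toNat)).commute_of_nonneg isGradedBy_homB hN hD (by omega) hp
      (by omega : d ≤ _) (by omega : e ≤ _) ha hb
  have hext : ∀ i, ∃ z : ringB M → G, (∀ f g, z (f + g) = z f * z g) ∧
      ∀ (d : ℤ) (a : ringB M), a ∈ homB M d → z a = y i a := fun i =>
    exists_additive_extension (y i)
      (fun d a b ha hb => ((H d.toNat).add i (by omega) ha hb).symm)
      (fun d e a b ha hb => hcomm (by rw [D.p_self]; norm_num) ha hb)
  choose z hadd hz using hext
  have hcommute : ∀ {i j : ι}, 0 ≤ D.p i j → ∀ a b, Commute (z i a) (z j b) := by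
    intro i j hp a b
    induction a using homB_induction with
    | hom d a ha =>
      induction b using homB_induction with
      | hom e b hb =>
        rw [hz i d a ha, hz j e b hb]
        exact hcomm hp ha hb
      | add b b' h h' => rw [hadd]; exact h.mul_right h'
    | add a a' h h' => rw [hadd]; exact h.mul_left h'
  have hcomm_add : ∀ {i j k : ι}, D.IsSum i j k → ∀ a b,
      ⁅z i a, z j b⁆ = z k (N i j • (a * b)) := by
    intro i j k h a b
    have hp := h.p_eq
    induction a using homB_induction with
    | hom d a ha =>
      induction b using homB_induction with
      | hom e b hb =>
        rw [hz i d a ha, hz j e b hb, hz k (d + e) _ ((homB M _).zsmul_mem (homB_mul_mem ha hb) _)]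
        exact (H (max (max d.toNat e.toNat) (d + e).toNat)).comm_add h (by omega) (by omega)
          (by omega) ha hb
      | add b b' hb hb' =>
        -- Bilinearity: the root `k` is acute to `i` and `j`, so the commutators already computed
        -- commute with the generators.
        rw [hadd, commutator_mul_right_of_commute, hb, hb', ← hadd, mul_add, smul_add]
        rw [hb']
        exact hcommute (by omega) _ _
    | add a a' ha ha' =>
      rw [hadd, commutator_mul_left_of_commute, ha, ha', ← hadd, add_mul, smul_add, add_comm]
      rw [ha']
      exact hcommute (by omega) _ _
  refine ⟨PresentedGroup.toGroup (f := fun g : ι × ringB M => z g.1 g.2) ?_,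
    fun i d a ha => (PresentedGroup.toGroup.of _).trans (hz i d a ha)⟩
  rintro r (hr : SteinbergRel P N (ringB M) r)
  cases hr with
  | add i a b =>
    simp only [map_mul, map_inv, FreeGroup.lift_apply_of]
    rw [hadd, mul_inv_cancel]
  | comm_add i j k a b hk =>
    simp only [map_mul, map_inv, map_commutatorElement, FreeGroup.lift_apply_of]
    rw [hcomm_add hk, mul_inv_cancel]
  | comm_one i j a b h0 h =>
    simp only [map_commutatorElement, FreeGroup.lift_apply_of]
    refine commutatorElement_eq_one_iff_commute.2 (hcommute ?_ a b)
    -- The case `i = j` is included, where the pairing is 2.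
    have h1 := D.neg_two_le i j
    have h2 : D.p i j ≠ -1 := fun h' => h (by
      obtain ⟨k, hk⟩ := D.exists_isSum i j h'
      exact ⟨k, hk⟩)
    have h3 : D.p i j ≠ -2 := fun h' => h0 (by
      have := (P.pairingIn_neg_two_neg_two_iff ℤ i j).1 ⟨h', (hs j i).trans h'⟩
      rw [this, neg_add_cancel])
    omega

/-- An element `x i a` with `a` of degree greater than `1` lies in every subgroup that contains
the elements of smaller degree. -/
theorem IsTruncFamily.mem_of_forall_mem {n d : ℤ} {y : ι → ringB M → G} {Q : Subgroup G}
    (H : IsTruncFamily (rootCombinatorics hs) N (homB M) n y)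
    (hN : (rootCombinatorics hs).IsStructureConstants N) (hD : (rootCombinatorics hs).IsAmple)
    (hd : 1 ≤ d) (hdn : d + 1 ≤ n)
    (hQ : ∀ (i : ι) (e : ℤ) (a : ringB M), e ≤ d → a ∈ homB M e → y i a ∈ Q)
    (i : ι) {a : ringB M} (ha : a ∈ homB M (d + 1)) : y i a ∈ Q := by
  set D := rootCombinatorics hs
  obtain ⟨β, hβ⟩ := hD.exists_acute i
  rw [D.p_symm] at hβ
  obtain ⟨γ, hγ⟩ := exists_isSum_sub hβ
  obtain ⟨a', ha', rfl⟩ := isGradedBy_homB.exists_eq_mul (by omega) ha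
  have h := H.comm_add hγ (by omega) (by omega) (by omega) isGradedBy_homB.mem
    ((homB M d).zsmul_mem ha' (N β γ))
  rw [mul_smul_comm, smul_smul, hN.sq hγ, one_smul] at h
  rw [← h]
  exact commutatorElement_mem (hQ β 1 _ hd isGradedBy_homB.mem)
    (hQ γ d _ le_rfl ((homB M d).zsmul_mem ha' _))

/-- The generators of level `n`, extended to level `n + 1` in the same group, define a left inverse;
in degree `n + 1` each generator is a commutator of generators in the image. -/
theorem bijective_incl (hN : (rootCombinatorics hs).IsStructureConstants N)
    (hD : (rootCombinatorics hs).IsAmple) {n : ℤ} (hn : 1 ≤ n) :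
    Function.Bijective (TruncSteinberg.incl P N M n) := by
  have hincl : ∀ (i : ι) (a : HomCoeff M n), TruncSteinberg.incl P N M n
      (TruncSteinberg.x P N M i a) = TruncSteinberg.x P N M i a.succ :=
    fun i a => PresentedGroup.toGroup.of _
  constructor
  · obtain ⟨y, hy, hyx⟩ := (isTruncFamily_truncFamily (N := N) (M := M) hs n).exists_succ
      isGradedBy_homB hN hD hn
    obtain ⟨ψ, hψ⟩ := exists_hom_of_isTruncFamily hs hy
    have : ψ.comp (TruncSteinberg.incl P N M n) = MonoidHom.id _ := by
      refine PresentedGroup.ext fun g => ?_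
      obtain ⟨i, a⟩ := g
      change ψ (TruncSteinberg.incl P N M n (TruncSteinberg.x P N M i a)) =
        TruncSteinberg.x P N M i a
      rw [hincl, hψ]
      obtain ⟨d, hd, ha⟩ := a.2
      exact (hyx i d a.1 hd ha).trans (truncFamily_eq i a)
    exact Function.LeftInverse.injective (g := ψ) fun g => DFunLike.congr_fun this g
  · rw [← MonoidHom.range_eq_top, eq_top_iff]
    intro g _
    refine PresentedGroup.generated_by _ _ (fun ⟨i, a⟩ => ?_) g
    have hlow : ∀ (i : ι) (e : ℤ) (a : ringB M), e ≤ n → a ∈ homB M e →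
        truncFamily P N M (n + 1) i a ∈ (TruncSteinberg.incl P N M n).range := by
      intro i e a he ha
      refine ⟨TruncSteinberg.x P N M i ⟨a, e, he, ha⟩, ?_⟩
      rw [hincl]
      exact (truncFamily_eq i _).symm
    change TruncSteinberg.x P N M i a ∈ _
    rw [← truncFamily_eq]
    obtain ⟨d, hd, ha⟩ := a.2
    rcases eq_or_lt_of_le hd with rfl | hd
    · exact (isTruncFamily_truncFamily hs (n + 1)).mem_of_forall_mem hs hN hD hn le_rfl hlow i ha
    · exact hlow i d _ (by omega) ha

/-- The left inverse comes from extending the generators of level 1 to all degrees. For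
surjectivity, homogeneous generators are reached by induction on the degree, the others by
additivity. -/
theorem exists_bijective_steinberg (hN : (rootCombinatorics hs).IsStructureConstants N)
    (hD : (rootCombinatorics hs).IsAmple) :
    ∃ φ : TruncSteinberg P N M 1 →* Steinberg P N (ringB M),
      (∀ (i : ι) (a : HomCoeff M 1),
        φ (TruncSteinberg.x P N M i a) = Steinberg.x P N i a.1) ∧ Function.Bijective φ := by
  obtain ⟨φ, hφ⟩ := exists_hom_of_isTruncFamily hs
    (isTruncFamily_steinberg (N := N) (M := M) hs 1)
  refine ⟨φ, hφ, ?_, ?_⟩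
  · obtain ⟨y, hy, hyx⟩ := (isTruncFamily_truncFamily (N := N) (M := M) hs 1).exists_forall
      isGradedBy_homB hN hD
    obtain ⟨ψ, hψ⟩ := exists_hom_of_forall_isTruncFamily hs hN hD hy
    have : ψ.comp φ = MonoidHom.id _ := by
      refine PresentedGroup.ext fun g => ?_
      obtain ⟨i, a⟩ := g
      change ψ (φ (TruncSteinberg.x P N M i a)) = TruncSteinberg.x P N M i a
      obtain ⟨d, hd, ha⟩ := a.2
      rw [hφ, hψ i d _ ha]
      exact (hyx i d a.1 hd ha).trans (truncFamily_eq i a)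
    exact Function.LeftInverse.injective (g := ψ) fun g => DFunLike.congr_fun this g
  · rw [← MonoidHom.range_eq_top, eq_top_iff]
    intro g _
    refine PresentedGroup.generated_by _ _ (fun ⟨i, f⟩ => ?_) g
    change Steinberg.x P N i f ∈ _
    have hlow : ∀ (k : ℕ) (i : ι) (e : ℤ) (a : ringB M), e ≤ k + 1 → a ∈ homB M e →
        Steinberg.x P N i a ∈ φ.range := by
      intro k
      induction k with
      | zero =>
        intro i e a he ha
        exact ⟨TruncSteinberg.x P N M i ⟨a, e, by simpa using he, ha⟩, hφ _ _⟩
      | succ k ih =>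
        intro i e a he ha
        rcases eq_or_lt_of_le he with rfl | he
        · exact (isTruncFamily_steinberg hs _).mem_of_forall_mem hs hN hD
            (by omega : (1 : ℤ) ≤ k + 1) le_rfl ih i (by exact_mod_cast ha)
        · exact ih i e a (by push_cast at he; omega) ha
    induction f using homB_induction with
    | hom d a ha => exact hlow d.toNat i d a (by omega) ha
    | add a b ha hb =>
      have := PresentedGroup.one_of_mem (rels := {r | SteinbergRel P N (ringB M) r})
        (SteinbergRel.add i a b)
      rw [map_mul, map_mul, map_inv, mul_inv_eq_one] at this
      change Steinberg.x P N i a * Steinberg.x P N i b = Steinberg.x P N i (a + b) at this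
      exact this ▸ φ.range.mul_mem ha hb

end Families

end GradedSteinberg

open GradedSteinberg in
theorem mainTheorem4 {ι K V W L A : Type*} [Finite ι] [Field K] [CharZero K]
    [AddCommGroup V] [Module K V] [AddCommGroup W] [Module K W]
    (P : RootPairing ι K V W) [P.IsRootSystem] [P.IsCrystallographic] [P.IsReduced]
    (hP : IsTypeADE P)
    [LieRing L] [LieAlgebra K L] (𝓒 : ChevalleyBasis P L)
    [CommRing A] (M : Ideal A) :
    (∀ n : ℤ, 1 ≤ n → Function.Bijective (TruncSteinberg.incl P 𝓒.N M n)) ∧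
    ∃ φ : TruncSteinberg P 𝓒.N M 1 →* Steinberg P 𝓒.N (ringB M),
      (∀ (i : ι) (a : HomCoeff M 1),
        φ (TruncSteinberg.x P 𝓒.N M i a) = Steinberg.x P 𝓒.N i a.1) ∧
      Function.Bijective φ := by
  obtain ⟨hs, hD⟩ := hP.isAmple
  have hN := 𝓒.isStructureConstants hs
  exact ⟨fun n hn => bijective_incl hs hN hD hn, exists_bijective_steinberg hs hN hD⟩
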